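/- Let $G$ be a Lie group acting smoothly, properly and by Riemannian isometries on a complete Riemannian manifold $M$ with volume measure $\operatorname{vol}$. Let $x_0\in M$ be a principal point, meaning that the isotropy group $Z=G_{x_0}$ acts trivially on $T_{x_0}(G\cdot x_0)^\perp$, and let $\Sigma\subset M$ be a normal slice through $x_0$: a connected embedded submanifold containing $x_0$ such that $T_{x_0}M=T_{x_0}(G\cdot x_0)\oplus T_{x_0}\Sigma$ is an orthogonal direct sum, $T_xM=T_x(G\cdot x)+T_x\Sigma$ for every $x\in\Sigma$, $\Sigma$ is invariant under $Z$, and $x,\,g\cdot x\in\Sigma$ implies $g\in Z$. Then $Z$ fixes every point of $\Sigma$, and $G\cdot\Sigma$ is identified with $(G/Z)\times\Sigma$ through $g\cdot x\leftrightarrow(gZ,x)$. Let $\operatorname{vol}_{G/Z}$ be the Riemannian volume measure of the orbit $G\cdot x_0\cong G/Z$. Let $\mu=\rho\operatorname{vol}$ be a finite absolutely continuous measure on $M$, with measurable density $\rho\ge 0$. For $x\in\Sigma$ let $\operatorname{vol}^x_\rho=\rho\,(\operatorname{vol}_{G/Z}\times\delta_x)$, a measure on $M$ carried by the orbit $G\cdot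 x$, and let $$\mu_x=\frac{\operatorname{vol}^x_\rho}{\operatorname{vol}^x_\rho\big((G/Z)\times\{x\}\big)}$$ (with $\mu_x=0$ if the total mass in the denominator is $0$ or $\infty$). Let $\psi:\Sigma\to\mathbb R$ be of class $C^3$, extended to $G\cdot\Sigma$ by $\psi(g\cdot x)=\psi(x)$, and let $T:G\cdot\Sigma\to M$, $T(y)=\exp_y(\nabla\psi(y))$. Suppose that $\rho$ is constant along horizontal directions, that is, $\rho(g\cdot x)=\rho(g\cdot y)$ for all $g\in G$ and $x,y\in\Sigma$. Then $T$ is $G$-equivariant, $T(g\cdot y)=g\cdot T(y)$ for $g\in G$ and $y\in G\cdot\Sigma$, and for every $x\in\Sigma$ with $T(x)\in\Sigma$ the map $T$ is a transport map between $\mu_x$ and $\mu_{T(x)}$: it is $\mu_x$-almost everywhere measurable, and $T_*\mu_x=\mu_{T(x)}$. -/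

import Mathlib

open MeasureTheory Manifold Bundle Set
open scoped ContDiff ENNReal

noncomputable section

section Riemannian

variable {E : Type*} [NormedAddCommGroup E] [NormedSpace ℝ E]
  {M : Type*} [TopologicalSpace M] [ChartedSpace E M]
  [RiemannianBundle (fun x : M => TangentSpace 𝓘(ℝ, E) x)]

/-- The components `κ_y(u, v) = ⟨d(e⁻¹)_y u, d(e⁻¹)_y v⟩` of the Riemannian metric in a chart
`e`, at the point `y` of the target of the chart. -/
def chartMetric (e : OpenPartialHomeomorph M E) (y u v : E) : ℝ :=
  inner ℝ (mfderiv 𝓘(ℝ, E) 𝓘(ℝ, E) e.symm y u : TangentSpace 𝓘(ℝ, E) (e.symm y))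
    (mfderiv 𝓘(ℝ, E) 𝓘(ℝ, E) e.symm y v : TangentSpace 𝓘(ℝ, E) (e.symm y))

/-- The Christoffel symbols of the first kind in a chart,
`[ab, w] = ½ (∂_a κ(b, w) + ∂_b κ(a, w) - ∂_w κ(a, b))`. -/
def chartChristoffel (e : OpenPartialHomeomorph M E) (y a b w : E) : ℝ :=
  (fderiv ℝ (fun z => chartMetric e z b w) y a + fderiv ℝ (fun z => chartMetric e z a w) y b
    - fderiv ℝ (fun z => chartMetric e z a b) y w) / 2

/-- `γ : ℝ → M` is a geodesic: it is smooth, and in every chart `e` of the atlas the coordinate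
curve `c = e ∘ γ` satisfies the geodesic equation of the Levi-Civita connection (with the index
lowered by the metric), `κ_c(c'', w) + [c' c', w] = 0` for all `w`. -/
def IsGeodesicCurve (γ : ℝ → M) : Prop :=
  ContMDiff 𝓘(ℝ, ℝ) 𝓘(ℝ, E) ∞ γ ∧
    ∀ e ∈ atlas E M, ∀ t : ℝ, γ t ∈ e.source → ∀ w : E,
      chartMetric e (e (γ t)) (deriv (deriv (fun s => e (γ s))) t) w
        + chartChristoffel e (e (γ t)) (deriv (fun s => e (γ s)) t)
            (deriv (fun s => e (γ s)) t) w = 0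

open Classical in
/-- The Riemannian exponential map: `exp_x v = γ 1` for the geodesic `γ : ℝ → M` with `γ 0 = x`
and `γ' 0 = v`. Such a geodesic is unique, and it exists when the manifold is complete
(otherwise the value is `x`). -/
def riemannianExp (x : M) (v : TangentSpace 𝓘(ℝ, E) x) : M :=
  if h : ∃ γ : ℝ → M, IsGeodesicCurve (E := E) γ ∧
      tangentMap 𝓘(ℝ, ℝ) 𝓘(ℝ, E) γ ⟨0, (1 : ℝ)⟩ = ⟨x, v⟩
  then h.choose 1 else x

/-- The Riemannian gradient: `⟨∇f(x), w⟩ = df_x(w)` for all `w ∈ T_x M`. -/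
def riemannianGradient [FiniteDimensional ℝ E] (f : M → ℝ) (x : M) : TangentSpace 𝓘(ℝ, E) x :=
  haveI : FiniteDimensional ℝ (TangentSpace 𝓘(ℝ, E) x) := inferInstanceAs (FiniteDimensional ℝ E)
  haveI : CompleteSpace (TangentSpace 𝓘(ℝ, E) x) := FiniteDimensional.complete ℝ _
  (InnerProductSpace.toDual ℝ (TangentSpace 𝓘(ℝ, E) x)).symm
    (mvfderiv 𝓘(ℝ, E) f x)

/-- The map `T(x) = exp_x(∇ψ(x))`. -/
def expGradientMap [FiniteDimensional ℝ E] (ψ : M → ℝ) (x : M) : M :=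
  riemannianExp (E := E) x (riemannianGradient (E := E) ψ x)

end Riemannian

/-- `T` is a transport map between `μ` and `ν`: `T` is `μ`-a.e. measurable and `T_* μ = ν`. -/
def IsTransportMap {X : Type*} [MeasurableSpace X] (T : X → X) (μ ν : Measure X) : Prop :=
  AEMeasurable T μ ∧ μ.map T = ν

section Action

variable {E : Type*} [NormedAddCommGroup E] [NormedSpace ℝ E]
  {E' : Type*} [NormedAddCommGroup E'] [NormedSpace ℝ E']
  {F : Type*} [NormedAddCommGroup F] [NormedSpace ℝ F]
  {S : Type*} [TopologicalSpace S] [ChartedSpace F S]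

section

variable (G : Type*) [TopologicalSpace G] [ChartedSpace E' G] [Group G]
  {M : Type*} [TopologicalSpace M] [ChartedSpace E M] [MulAction G M]

/-- The space of vertical vectors `T_x(G·x) = d(g ↦ g·x)_e 𝔤`, a subspace of `T_x M`. -/
def verticalSpace (x : M) : Submodule ℝ (TangentSpace 𝓘(ℝ, E) x) :=
  (one_smul G x ▸ mfderiv 𝓘(ℝ, E') 𝓘(ℝ, E) (fun g : G => g • x) 1 :
    TangentSpace 𝓘(ℝ, E') (1 : G) →L[ℝ] TangentSpace 𝓘(ℝ, E) x).range

/-- The tangent space `T_{ι s} Σ` of the submanifold `Σ = ι(S)`, a subspace of `T_{ι s} M`. -/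
def imageTangentSpace (ι : S → M) (s : S) : Submodule ℝ (TangentSpace 𝓘(ℝ, E) (ι s)) :=
  (mfderiv 𝓘(ℝ, F) 𝓘(ℝ, E) ι s).range

variable [RiemannianBundle (fun x : M => TangentSpace 𝓘(ℝ, E) x)]

variable (E M) in
/-- Every left translation `x ↦ g·x` is a Riemannian isometry: its differential preserves the
metric. -/
def IsRiemannianIsometricAction : Prop :=
  ∀ (g : G) (x : M) (u v : TangentSpace 𝓘(ℝ, E) x),
    inner ℝ (mfderiv 𝓘(ℝ, E) 𝓘(ℝ, E) (fun y : M => g • y) x u)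
      (mfderiv 𝓘(ℝ, E) 𝓘(ℝ, E) (fun y : M => g • y) x v) = inner ℝ u v

/-- `x` is a principal point: its slice representation, i.e. the linear action of the isotropy
group `G_x` on the horizontal space `T_x(G·x)^⊥`, is trivial. -/
def IsPrincipalPoint (x : M) : Prop :=
  ∀ g ∈ MulAction.stabilizer G x, ∀ v : TangentSpace 𝓘(ℝ, E) x,
    (∀ u ∈ verticalSpace (E := E) (E' := E') G x, inner ℝ u v = 0) →
      tangentMap 𝓘(ℝ, E) 𝓘(ℝ, E) (fun y : M => g • y) ⟨x, v⟩ = ⟨x, v⟩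

/-- The embedded submanifold `Σ = ι(S)` is a normal slice of the action through the point
`ι s₀`. -/
structure IsNormalSlice (ι : S → M) (s₀ : S) : Prop where
  isSmoothEmbedding : IsSmoothEmbedding 𝓘(ℝ, F) 𝓘(ℝ, E) ∞ ι
  /-- `T_{x₀} M = T_{x₀}(G·x₀) ⊕ T_{x₀} Σ` -/
  isCompl : IsCompl (verticalSpace (E := E) (E' := E') G (ι s₀))
    (imageTangentSpace (E := E) (F := F) ι s₀)
  /-- `T_x M = T_x(G·x) + T_x Σ` for every `x ∈ Σ` -/
  sup_eq_top : ∀ s : S, verticalSpace (E := E) (E' := E') G (ι s)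
    ⊔ imageTangentSpace (E := E) (F := F) ι s = ⊤
  /-- `Σ` is invariant under `G_{x₀}` -/
  smul_mem : ∀ g ∈ MulAction.stabilizer G (ι s₀), ∀ x ∈ range ι, g • x ∈ range ι
  /-- if `x ∈ Σ` and `g·x ∈ Σ`, then `g ∈ G_{x₀}` -/
  mem_stabilizer : ∀ (g : G), ∀ x ∈ range ι, g • x ∈ range ι → g ∈ MulAction.stabilizer G (ι s₀)
  /-- `T_{x₀} Σ` is orthogonal to `T_{x₀}(G·x₀)` -/
  orthogonal : ∀ u ∈ verticalSpace (E := E) (E' := E') G (ι s₀),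
    ∀ v ∈ imageTangentSpace (E := E) (F := F) ι s₀, inner ℝ u v = 0

end

section

variable {M : Type*} [EMetricSpace M] [MeasurableSpace M] [BorelSpace M] [ChartedSpace E M]

variable (E M) in
/-- The Riemannian volume measure of `M`: the Hausdorff measure of the Riemannian distance in
dimension `dim M`, normalized as Lebesgue measure on Euclidean spaces. -/
def riemannianVol : Measure M := μHE[Module.finrank ℝ E]

variable (G : Type*) [TopologicalSpace G] [ChartedSpace E' G] [Group G] [MulAction G M]

/-- The Riemannian volume measure `vol_{G/Z}` of the orbit `G·x₀ ≅ G/Z`, `Z = G_{x₀}`, as an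
embedded submanifold of `M` (a measure on `M` carried by the orbit): the Hausdorff measure in
dimension `dim (G·x₀)`. -/
def orbitVol (x₀ : M) : Measure M :=
  (μHE[Module.finrank ℝ (verticalSpace (E := E) (E' := E') G x₀)]).restrict (MulAction.orbit G x₀)

open Classical in
/-- The map `G·x₀ → G·x`, `g·x₀ ↦ g·x` (it does not depend on the choice of `g` when `G_{x₀}`
fixes `x`; outside of `G·x₀` the value is irrelevant). In the identification
`(gZ, x) ↔ g·x` of `(G/Z) × Σ` with `G·Σ`, it is `(gZ, x₀) ↦ (gZ, x)`. -/
def orbitTransfer (x₀ x y : M) : M :=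
  if h : ∃ g : G, g • x₀ = y then h.choose • x else y

/-- `vol^x_ρ = ρ (vol_{G/Z} × δ_x)`, where `vol_{G/Z} × δ_x` is the measure `vol_{G/Z}` transferred
to the orbit of `x` by `(gZ, x₀) ↦ (gZ, x)`. -/
def weightedOrbitVol (x₀ : M) (ρ : M → ℝ≥0∞) (x : M) : Measure M :=
  ((orbitVol (E := E) (E' := E') G x₀).map (orbitTransfer G x₀ x)).withDensity ρ

/-- The conditional measure `μ_x = vol^x_ρ / vol^x_ρ((G/Z) × {x})` of `μ = ρ vol`. -/
def conditionalMeasure (x₀ : M) (ρ : M → ℝ≥0∞) (x : M) : Measure M :=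
  (weightedOrbitVol (E := E) (E' := E') G x₀ ρ x (MulAction.orbit G x))⁻¹ •
    weightedOrbitVol (E := E) (E' := E') G x₀ ρ x

end

end Action

end

/-! The map `T = exp ∇ψ` is built from the metric and `ψ`, so it commutes with every isometry
preserving `ψ` near the point considered. The hypothesis `T_xM = T_x(G·x) + T_xΣ` makes `G·Σ` open
(`saturation_mem_nhds`), so the invariance of `ψ` on `G·Σ` holds near each of its points and `T` is
equivariant there (`expGradientMap_isometry`). As `exp` selects a geodesic by choice, this rests on
two facts: isometries map geodesics to geodesics (`IsGeodesicCurve.comp_isometry`), and a geodesic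
is determined by one velocity vector (`IsGeodesicCurve.eq_of_tangentMap_eq`).

The group `Z` fixes `Σ` pointwise (`IsNormalSlice.stabilizer_smul_eq`). It is compact, preserves
`Σ`, and acts trivially to first order at `x₀`. A point of `Σ` moved near a point with this property
would drift linearly under iteration, while compactness keeps its orbit bounded; connectedness then
spreads the conclusion over `Σ`.

Hence `τ_x : g·x₀ ↦ g·x` is well defined for `x ∈ Σ`. Equivariance gives `T ∘ τ_x = τ_{T x}` on
`G·x₀`, and horizontal constancy gives `ρ ∘ τ_x = ρ ∘ τ_{T x}` there. So `T` carries one weighted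
orbit volume to the other, their masses agree, and the normalized measures correspond
(`isTransportMap_conditionalMeasure`). -/

noncomputable section

set_option maxSynthPendingDepth 3

open Filter Topology

/-! ### The geodesic equation in a vector space: change of coordinates and uniqueness. -/

section LoweredChristoffel

variable {E : Type*} [NormedAddCommGroup E] [NormedSpace ℝ E]

/-- The Christoffel symbols of the first kind of a field of bilinear forms on a vector space. -/
def loweredChristoffel (κ : E → E →L[ℝ] E →L[ℝ] ℝ) (y a b w : E) : ℝ :=
  (fderiv ℝ (fun z => κ z b w) y a + fderiv ℝ (fun z => κ z a w) y b
    - fderiv ℝ (fun z => κ z a b) y w) / 2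

lemma fderiv_clm_apply_apply {κ : E → E →L[ℝ] E →L[ℝ] ℝ} {y : E}
    (hκ : DifferentiableAt ℝ κ y) (a b w : E) :
    fderiv ℝ (fun z => κ z b w) y a = fderiv ℝ κ y a b w := by
  have h1 : HasFDerivAt (fun z => κ z b) _ y := hκ.hasFDerivAt.clm_apply (hasFDerivAt_const b y)
  have h2 : HasFDerivAt (fun z => κ z b w) _ y := h1.clm_apply (hasFDerivAt_const w y)
  rw [h2.fderiv]
  simp

lemma loweredChristoffel_eq {κ : E → E →L[ℝ] E →L[ℝ] ℝ} {y : E}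
    (hκ : DifferentiableAt ℝ κ y) (a b w : E) :
    loweredChristoffel κ y a b w
      = (fderiv ℝ κ y a b w + fderiv ℝ κ y b a w - fderiv ℝ κ y w a b) / 2 := by
  simp only [loweredChristoffel, fderiv_clm_apply_apply hκ]

/-- The derivative of the pullback of a field of bilinear forms. -/
lemma fderiv_pullback_apply {κ κ' : E → E →L[ℝ] E →L[ℝ] ℝ} {φ : E → E} {y : E}
    (hφ : ContDiffAt ℝ 2 φ y) (hκ : DifferentiableAt ℝ κ (φ y))
    (h : ∀ᶠ z in 𝓝 y, ∀ u v, κ' z u v = κ (φ z) (fderiv ℝ φ z u) (fderiv ℝ φ z v))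
    (a b w : E) :
    fderiv ℝ (fun z => κ' z b w) y a
      = fderiv ℝ κ (φ y) (fderiv ℝ φ y a) (fderiv ℝ φ y b) (fderiv ℝ φ y w)
        + κ (φ y) (fderiv ℝ (fderiv ℝ φ) y a b) (fderiv ℝ φ y w)
        + κ (φ y) (fderiv ℝ φ y b) (fderiv ℝ (fderiv ℝ φ) y a w) := by
  have hd : DifferentiableAt ℝ φ y := hφ.differentiableAt (by norm_num)
  have hdd : DifferentiableAt ℝ (fderiv ℝ φ) y :=
    (hφ.fderiv_right (m := 1) (by norm_num)).differentiableAt (by norm_num)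
  have e1 : (fun z => κ' z b w) =ᶠ[𝓝 y]
      fun z => κ (φ z) (fderiv ℝ φ z b) (fderiv ℝ φ z w) := h.mono fun z hz => hz b w
  rw [e1.fderiv_eq]
  have hb : HasFDerivAt (fun z => fderiv ℝ φ z b) _ y :=
    hdd.hasFDerivAt.clm_apply (hasFDerivAt_const b y)
  have hw : HasFDerivAt (fun z => fderiv ℝ φ z w) _ y :=
    hdd.hasFDerivAt.clm_apply (hasFDerivAt_const w y)
  have hk : HasFDerivAt (fun z => κ (φ z)) _ y :=
    HasFDerivAt.comp (g := κ) y hκ.hasFDerivAt hd.hasFDerivAt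
  have h1 : HasFDerivAt (fun z => κ (φ z) (fderiv ℝ φ z b) (fderiv ℝ φ z w)) _ y :=
    (hk.clm_apply hb).clm_apply hw
  rw [h1.fderiv]
  simp
  ring

/-- Invariance of the geodesic equation under a change of coordinates. -/
lemma geodesic_equation_of_pullback {κ κ' : E → E →L[ℝ] E →L[ℝ] ℝ} {φ : E → E} {c c' : ℝ → E}
    {t : ℝ} (hφ : ContDiffAt ℝ 2 φ (c' t)) (hκ : DifferentiableAt ℝ κ (φ (c' t)))
    (hsymm : ∀ u v, κ (φ (c' t)) u v = κ (φ (c' t)) v u)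
    (h : ∀ᶠ z in 𝓝 (c' t), ∀ u v, κ' z u v = κ (φ z) (fderiv ℝ φ z u) (fderiv ℝ φ z v))
    (hc' : ContDiffAt ℝ 2 c' t) (hc : c =ᶠ[𝓝 t] φ ∘ c')
    (hgeo : ∀ w, κ (c t) (deriv (deriv c) t) w
      + loweredChristoffel κ (c t) (deriv c t) (deriv c t) w = 0) (w : E) :
    κ' (c' t) (deriv (deriv c') t) w
      + loweredChristoffel κ' (c' t) (deriv c' t) (deriv c' t) w = 0 := by
  have hdc : ∀ᶠ s in 𝓝 t, HasDerivAt c' (deriv c' s) s := by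
    filter_upwards [hc'.eventually (by simp)] with s hs
    exact (hs.differentiableAt (by norm_num)).hasDerivAt
  have hddc : HasDerivAt (deriv c') (deriv (deriv c') t) t := by
    have := (hc'.fderiv_right (m := 1) (by norm_num)).differentiableAt (by norm_num)
    have h2 : DifferentiableAt ℝ (deriv c') t := by
      have := this.clm_apply (differentiableAt_const (1 : ℝ))
      simpa only [fderiv_apply_one_eq_deriv] using this
    exact h2.hasDerivAt
  have hdφ : ∀ᶠ z in 𝓝 (c' t), HasFDerivAt φ (fderiv ℝ φ z) z := by
    filter_upwards [hφ.eventually (by simp)] with s hs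
    exact (hs.differentiableAt (by norm_num)).hasFDerivAt
  have hddφ : HasFDerivAt (fderiv ℝ φ) (fderiv ℝ (fderiv ℝ φ) (c' t)) (c' t) :=
    ((hφ.fderiv_right (m := 1) (by norm_num)).differentiableAt (by norm_num)).hasFDerivAt
  have hd1 : deriv c =ᶠ[𝓝 t] fun s => fderiv ℝ φ (c' s) (deriv c' s) := by
    filter_upwards [hc.eventuallyEq_nhds, hdc, hc'.continuousAt.eventually hdφ] with s h1 h2 h3
    rw [h1.deriv_eq]
    exact (h3.comp_hasDerivAt s h2).deriv
  have hd2 : deriv (deriv c) t = fderiv ℝ (fderiv ℝ φ) (c' t) (deriv c' t) (deriv c' t)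
      + fderiv ℝ φ (c' t) (deriv (deriv c') t) := by
    rw [hd1.deriv_eq]
    have h1 : HasDerivAt (fun s => fderiv ℝ φ (c' s)) _ t :=
      hddφ.comp_hasDerivAt t hdc.self_of_nhds
    exact (h1.clm_apply hddc).deriv
  have hs : ∀ u v, fderiv ℝ (fderiv ℝ φ) (c' t) u v = fderiv ℝ (fderiv ℝ φ) (c' t) v u :=
    second_derivative_symmetric_of_eventually hdφ hddφ
  have hct : c t = φ (c' t) := hc.self_of_nhds
  -- Testing against `dφ w` suffices. The Christoffel symbol of the pullback exceeds that of `κ` by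
  -- `κ(D²φ(c', c'), dφ w)`, the term that the chain rule adds to the acceleration; the other
  -- second-order terms cancel by the symmetry of `κ` and of `D²φ`.
  have key := hgeo (fderiv ℝ φ (c' t) w)
  rw [hct, hd2, hd1.self_of_nhds, loweredChristoffel_eq hκ] at key
  rw [loweredChristoffel, h.self_of_nhds]
  simp only [fderiv_pullback_apply hφ hκ h]
  rw [hsymm (fderiv ℝ φ (c' t) (deriv c' t)) (fderiv ℝ (fderiv ℝ φ) (c' t) w (deriv c' t)),
    hs w, hsymm (fderiv ℝ φ (c' t) (deriv c' t))
      (fderiv ℝ (fderiv ℝ φ) (c' t) (deriv c' t) w)]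
  simp only [map_add, add_apply] at key ⊢
  linarith

/-- Local uniqueness of geodesics in coordinates. -/
lemma geodesic_equation_unique [FiniteDimensional ℝ E] {κ : E → E →L[ℝ] E →L[ℝ] ℝ}
    {c₁ c₂ : ℝ → E} {t : ℝ}
    (hκ : ContDiffAt ℝ 2 κ (c₁ t)) (hpos : ∀ᶠ z in 𝓝 (c₁ t), ∀ u, κ z u u = 0 → u = 0)
    (h₁ : ContDiffAt ℝ 2 c₁ t) (h₂ : ContDiffAt ℝ 2 c₂ t)
    (h0 : c₁ t = c₂ t) (hd0 : deriv c₁ t = deriv c₂ t)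
    (hg₁ : ∀ᶠ s in 𝓝 t, ∀ w, κ (c₁ s) (deriv (deriv c₁) s) w
      + loweredChristoffel κ (c₁ s) (deriv c₁ s) (deriv c₁ s) w = 0)
    (hg₂ : ∀ᶠ s in 𝓝 t, ∀ w, κ (c₂ s) (deriv (deriv c₂) s) w
      + loweredChristoffel κ (c₂ s) (deriv c₂ s) (deriv c₂ s) w = 0) :
    c₁ =ᶠ[𝓝 t] c₂ := by
  have : CompleteSpace E := FiniteDimensional.complete ℝ E
  -- `Γ (x, v)` is the functional `w ↦ [vv, w]`, and `V` is the first-order system `(x, v)' = (v,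
  -- -κ⁻¹Γ)`. As `κ` is `C²` and invertible at the point, `V` is `C¹`, hence Lipschitz nearby, and
  -- ODE uniqueness applies.
  let Γ : E × E → (E →L[ℝ] ℝ) := fun p =>
    fderiv ℝ κ p.1 p.2 p.2 - (2⁻¹ : ℝ) • ((fderiv ℝ κ p.1).flip p.2).flip p.2
  let V : E × E → E × E := fun p => (p.2, -((κ p.1).inverse (Γ p)))
  have hequiv : ∀ z, (∀ u, κ z u u = 0 → u = 0) →
      ∃ L : E ≃L[ℝ] (E →L[ℝ] ℝ), (L : E →L[ℝ] E →L[ℝ] ℝ) = κ z := by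
    intro z hz
    have hinj : Function.Injective (κ z : E →ₗ[ℝ] E →L[ℝ] ℝ) := by
      refine (injective_iff_map_eq_zero _).2 fun u hu => hz u ?_
      have : κ z u = 0 := hu
      simp [this]
    have hfr : Module.finrank ℝ E = Module.finrank ℝ (E →L[ℝ] ℝ) := by
      rw [← (LinearMap.toContinuousLinearMap (𝕜 := ℝ) (E := E) (F' := ℝ)).finrank_eq]
      exact (Subspace.dual_finrank_eq (K := ℝ) (V := E)).symm
    refine ⟨(LinearMap.linearEquivOfInjective _ hinj hfr).toContinuousLinearEquiv, ?_⟩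
    ext u v
    rfl
  have hVc : ContDiffAt ℝ 1 V (c₁ t, deriv c₁ t) := by
    obtain ⟨L, hL⟩ := hequiv _ hpos.self_of_nhds
    have hf : ContDiffAt ℝ 1 (fderiv ℝ κ) (c₁ t) := hκ.fderiv_right (by norm_num)
    have hfst : ContDiffAt ℝ 1 (fun p : E × E => p.1) (c₁ t, deriv c₁ t) := contDiffAt_fst
    have hsnd : ContDiffAt ℝ 1 (fun p : E × E => p.2) (c₁ t, deriv c₁ t) := contDiffAt_snd
    have hf' : ContDiffAt ℝ 1 (fun p : E × E => fderiv ℝ κ p.1) (c₁ t, deriv c₁ t) :=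
      ContDiffAt.comp (g := fderiv ℝ κ) (c₁ t, deriv c₁ t) hf hfst
    have hflip : ContDiffAt ℝ 1 (fun p : E × E => ((fderiv ℝ κ p.1).flip p.2).flip p.2)
        (c₁ t, deriv c₁ t) := by
      have h1 := ((ContinuousLinearMap.flipₗᵢ ℝ E E
        (E →L[ℝ] ℝ)).toContinuousLinearEquiv.contDiff.contDiffAt.comp
          (c₁ t, deriv c₁ t) hf').clm_apply hsnd
      exact ((ContinuousLinearMap.flipₗᵢ ℝ E E ℝ).toContinuousLinearEquiv.contDiff.contDiffAt.comp
          (c₁ t, deriv c₁ t) h1).clm_apply hsnd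
    have hΓ : ContDiffAt ℝ 1 Γ (c₁ t, deriv c₁ t) :=
      ((hf'.clm_apply hsnd).clm_apply hsnd).sub (hflip.const_smul (2⁻¹ : ℝ))
    have hinv : ContDiffAt ℝ 1 (fun p : E × E => (κ p.1).inverse) (c₁ t, deriv c₁ t) := by
      have h1 : ContDiffAt ℝ 1 (ContinuousLinearMap.inverse : (E →L[ℝ] E →L[ℝ] ℝ) → _)
          (κ (c₁ t)) := hL ▸ contDiffAt_map_inverse L
      have h2 : ContDiffAt ℝ 1 (fun p : E × E => κ p.1) (c₁ t, deriv c₁ t) :=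
        ContDiffAt.comp (g := κ) (c₁ t, deriv c₁ t) (hκ.of_le (by norm_num)) hfst
      exact ContDiffAt.comp (g := ContinuousLinearMap.inverse) (c₁ t, deriv c₁ t) h1 h2
    exact hsnd.prodMk (hinv.clm_apply hΓ).neg
  obtain ⟨K, U, hU, hlip⟩ := hVc.exists_lipschitzOnWith
  have main : ∀ c : ℝ → E, c t = c₁ t → deriv c t = deriv c₁ t → ContDiffAt ℝ 2 c t →
      (∀ᶠ s in 𝓝 t, ∀ w, κ (c s) (deriv (deriv c) s) w
        + loweredChristoffel κ (c s) (deriv c s) (deriv c s) w = 0) →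
      ∀ᶠ s in 𝓝 t, HasDerivAt (fun s => (c s, deriv c s)) (V (c s, deriv c s)) s ∧
        (c s, deriv c s) ∈ U := by
    intro c hct hdct hc hg
    have hdc : ContDiffAt ℝ 1 (deriv c) t := by
      have := (hc.fderiv_right (m := 1) (by norm_num)).clm_apply
        (contDiffAt_const (c := (1 : ℝ)))
      simpa only [fderiv_apply_one_eq_deriv] using this
    have hcU : ∀ᶠ s in 𝓝 t, (c s, deriv c s) ∈ U := by
      have : ContinuousAt (fun s => (c s, deriv c s)) t :=
        hc.continuousAt.prodMk hdc.continuousAt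
      apply this
      simpa only [hct, hdct] using hU
    have hκ' : ∀ᶠ s in 𝓝 t, DifferentiableAt ℝ κ (c s) := by
      apply hc.continuousAt.eventually
      rw [hct]
      filter_upwards [hκ.eventually (by simp)] with z hz using hz.differentiableAt (by norm_num)
    have hpos' : ∀ᶠ s in 𝓝 t, ∀ u, κ (c s) u u = 0 → u = 0 := by
      exact hc.continuousAt.eventually (p := fun z => ∀ u, κ z u u = 0 → u = 0) (hct ▸ hpos)
    filter_upwards [hcU, hg, hκ', hpos', hc.eventually (by simp), hdc.eventually (by simp)]
      with s s1 s2 s3 s4 s5 s6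
    refine ⟨?_, s1⟩
    obtain ⟨L, hL⟩ := hequiv _ s4
    have hA : deriv (deriv c) s = -((κ (c s)).inverse (Γ (c s, deriv c s))) := by
      rw [← hL, ContinuousLinearMap.inverse_equiv, ← map_neg]
      apply L.injective
      have : L (deriv (deriv c) s) = κ (c s) (deriv (deriv c) s) := by rw [← hL]; rfl
      rw [this]
      ext w
      have := s2 w
      rw [loweredChristoffel_eq s3] at this
      simp [Γ]
      linarith
    have := (s5.differentiableAt (by norm_num)).hasDerivAt.prodMk
      (s6.differentiableAt (by norm_num)).hasDerivAt
    rw [hA] at this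
    exact this
  have hu := ODE_solution_unique_of_eventually (v := fun _ => V) (s := fun _ => U) (K := K)
    (f := fun s => (c₁ s, deriv c₁ s)) (g := fun s => (c₂ s, deriv c₂ s)) (t₀ := t)
    (.of_forall fun _ => hlip) (main c₁ rfl rfl h₁ hg₁) (main c₂ h0.symm hd0.symm h₂ hg₂)
    (by simp only [h0, hd0])
  exact hu.mono fun s hs => congrArg Prod.fst hs

end LoweredChristoffel

/-! ### Geodesics and the exponential map under isometries. -/

section Geodesics

variable {E : Type*} [NormedAddCommGroup E] [NormedSpace ℝ E]
  {M : Type*} [TopologicalSpace M] [ChartedSpace E M]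

lemma contDiffAt_chart_comp_curve [IsManifold 𝓘(ℝ, E) ∞ M] {e : OpenPartialHomeomorph M E}
    (he : e ∈ atlas E M) {γ : ℝ → M} (hγ : ContMDiff 𝓘(ℝ, ℝ) 𝓘(ℝ, E) ∞ γ) {t : ℝ}
    (ht : γ t ∈ e.source) : ContDiffAt ℝ ∞ (fun s => e (γ s)) t := by
  have h1 : ContMDiffAt 𝓘(ℝ, E) 𝓘(ℝ, E) ∞ e (γ t) :=
    contMDiffAt_of_mem_maximalAtlas (IsManifold.subset_maximalAtlas he) ht
  exact contMDiffAt_iff_contDiffAt.1 (ContMDiffAt.comp (g := e) t h1 (hγ t))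

lemma deriv_chart_comp_curve [IsManifold 𝓘(ℝ, E) ∞ M] {e : OpenPartialHomeomorph M E}
    (he : e ∈ atlas E M) {γ : ℝ → M} (hγ : ContMDiff 𝓘(ℝ, ℝ) 𝓘(ℝ, E) ∞ γ) {t : ℝ}
    (ht : γ t ∈ e.source) : deriv (fun s => e (γ s)) t
      = (fun p : TangentBundle 𝓘(ℝ, E) E => (p.2 : E)) (tangentMap 𝓘(ℝ, E) 𝓘(ℝ, E) e
          (tangentMap 𝓘(ℝ, ℝ) 𝓘(ℝ, E) γ ⟨t, (1 : ℝ)⟩)) := by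
  have h1 : MDifferentiableAt 𝓘(ℝ, E) 𝓘(ℝ, E) e (γ t) :=
    (contMDiffAt_of_mem_maximalAtlas (n := ∞) (IsManifold.subset_maximalAtlas he)
      ht).mdifferentiableAt (by simp)
  rw [← tangentMap_comp_at _ h1 ((hγ t).mdifferentiableAt (by simp))]
  rw [← fderiv_apply_one_eq_deriv, ← mfderiv_eq_fderiv]
  rfl

variable [RiemannianBundle (fun x : M => TangentSpace 𝓘(ℝ, E) x)]

/-- The Riemannian metric, as a function of the base point and of two vectors of the model space. -/
def riemannianForm (x : M) (u v : E) : ℝ :=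
  @inner ℝ (TangentSpace 𝓘(ℝ, E) x) _ u v

lemma chartMetric_eq_riemannianForm (e : OpenPartialHomeomorph M E) (y u v : E) :
    chartMetric e y u v = riemannianForm (E := E) (e.symm y) (mfderiv 𝓘(ℝ, E) 𝓘(ℝ, E) e.symm y u)
      (mfderiv 𝓘(ℝ, E) 𝓘(ℝ, E) e.symm y v) := rfl

/-- `f` preserves the Riemannian metric. -/
def PreservesRiemannianForm (f : M → M) : Prop :=
  ∀ (x : M) (u v : E), riemannianForm (E := E) (f x) (mfderiv 𝓘(ℝ, E) 𝓘(ℝ, E) f x u : E)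
    (mfderiv 𝓘(ℝ, E) 𝓘(ℝ, E) f x v : E) = riemannianForm x u v

/-- The metric in a chart as a field of continuous bilinear forms. -/
def chartMetricCLM [FiniteDimensional ℝ E] (e : OpenPartialHomeomorph M E) (y : E) :
    E →L[ℝ] E →L[ℝ] ℝ :=
  LinearMap.toContinuousLinearMap (LinearMap.toContinuousLinearMap.toLinearMap ∘ₗ
    (LinearMap.mk₂ ℝ (chartMetric e y)
      (fun u u' v => by simp only [chartMetric]; erw [map_add, inner_add_left])
      (fun c u v => by simp only [chartMetric]; erw [map_smul, real_inner_smul_left]; rfl)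
      (fun u v v' => by simp only [chartMetric]; erw [map_add, inner_add_right])
      (fun c u v => by simp only [chartMetric]; erw [map_smul, real_inner_smul_right]; rfl)))

lemma chartMetric_symm (e : OpenPartialHomeomorph M E) (y u v : E) :
    chartMetric e y u v = chartMetric e y v u :=
  real_inner_comm _ _

lemma eq_zero_of_chartMetric_self [IsManifold 𝓘(ℝ, E) ∞ M] {e : OpenPartialHomeomorph M E}
    (he : e ∈ atlas E M) {y : E} (hy : y ∈ e.target) {u : E} (h : chartMetric e y u u = 0) :
    u = 0 := by
  have h1 : mfderiv 𝓘(ℝ, E) 𝓘(ℝ, E) e.symm y u = 0 := inner_self_eq_zero.1 h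
  have h2 := (mdifferentiable_of_mem_atlas (I := 𝓘(ℝ, E)) he).symm.mfderiv_injective
    (x := y) hy
  exact h2 (h1.trans (map_zero _).symm)

/-- The metric in a chart is the pullback, by an isometry written in charts, of the metric in another
chart. -/
lemma chartMetric_pullback [IsManifold 𝓘(ℝ, E) ∞ M] {f : M → M} (hf : ContMDiff 𝓘(ℝ, E) 𝓘(ℝ, E) ∞ f)
    (hiso : PreservesRiemannianForm (E := E) f) {e e₀ : OpenPartialHomeomorph M E}
    (he : e ∈ atlas E M) (he₀ : e₀ ∈ atlas E M) {y : E} (hy : y ∈ e.target)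
    (hy₀ : f (e.symm y) ∈ e₀.source) (u v : E) :
    chartMetric e y u v = chartMetric e₀ (e₀ (f (e.symm y)))
      (fderiv ℝ (fun z => e₀ (f (e.symm z))) y u) (fderiv ℝ (fun z => e₀ (f (e.symm z))) y v) := by
  have hs : MDifferentiableAt 𝓘(ℝ, E) 𝓘(ℝ, E) e.symm y :=
    mdifferentiableAt_atlas_symm he hy
  have hfs : MDifferentiableAt 𝓘(ℝ, E) 𝓘(ℝ, E) (f ∘ e.symm) y :=
    MDifferentiableAt.comp y ((hf _).mdifferentiableAt (by simp)) hs
  have he₀s : MDifferentiableAt 𝓘(ℝ, E) 𝓘(ℝ, E) e₀ (f (e.symm y)) :=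
    mdifferentiableAt_atlas he₀ hy₀
  have he₀t : MDifferentiableAt 𝓘(ℝ, E) 𝓘(ℝ, E) e₀.symm (e₀ (f (e.symm y))) :=
    mdifferentiableAt_atlas_symm he₀ (e₀.map_source hy₀)
  have hφ : MDifferentiableAt 𝓘(ℝ, E) 𝓘(ℝ, E) (fun z => e₀ (f (e.symm z))) y :=
    MDifferentiableAt.comp (g := e₀) (f := f ∘ e.symm) y he₀s hfs
  -- Two factorizations of the same germ: the chain rule applied to both identifies the
  -- pushed-forward coordinate vectors.
  have hev : (e₀.symm ∘ fun z => e₀ (f (e.symm z))) =ᶠ[𝓝 y] f ∘ e.symm := by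
    have : ∀ᶠ z in 𝓝 y, f (e.symm z) ∈ e₀.source :=
      hfs.continuousAt.eventually (e₀.open_source.mem_nhds hy₀)
    filter_upwards [this] with z hz using e₀.left_inv hz
  have h1 : ∀ w : E, (mfderiv 𝓘(ℝ, E) 𝓘(ℝ, E) f (e.symm y)
      (mfderiv 𝓘(ℝ, E) 𝓘(ℝ, E) e.symm y w) : E)
      = (mfderiv 𝓘(ℝ, E) 𝓘(ℝ, E) e₀.symm (e₀ (f (e.symm y)))
        (fderiv ℝ (fun z => e₀ (f (e.symm z))) y w) : E) := by
    intro w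
    have a := mfderiv_comp_apply y ((hf _).mdifferentiableAt (by simp)) hs w
    have b := mfderiv_comp_apply (g := e₀.symm) y he₀t hφ w
    rw [hev.mfderiv_eq] at b
    rw [mfderiv_eq_fderiv] at b
    exact a.symm.trans b
  rw [chartMetric_eq_riemannianForm, chartMetric_eq_riemannianForm]
  refine (hiso (e.symm y) _ _).symm.trans ?_
  refine (congrArg₂ (riemannianForm (E := E) (f (e.symm y))) (h1 u) (h1 v)).trans ?_
  exact congrArg (fun p => riemannianForm (E := E) p _ _) (e₀.left_inv hy₀).symm

variable [IsManifold 𝓘(ℝ, E) ∞ M]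
  [IsContMDiffRiemannianBundle 𝓘(ℝ, E) ∞ E (fun x : M => TangentSpace 𝓘(ℝ, E) x)]

/-- The coordinate fields are the images of constant fields under the tangent map of `e.symm`, hence
smooth along `e.symm`; the smooth bundle metric then pairs them smoothly. -/
lemma contDiffOn_chartMetric {e : OpenPartialHomeomorph M E} (he : e ∈ atlas E M) (u v : E) :
    ContDiffOn ℝ ∞ (fun y => chartMetric e y u v) e.target := by
  rw [← contMDiffOn_iff_contDiffOn]
  have hs : ContMDiffOn 𝓘(ℝ, E) 𝓘(ℝ, E) ∞ e.symm e.target :=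
    contMDiffOn_symm_of_mem_maximalAtlas (IsManifold.subset_maximalAtlas he)
  have key : ∀ w : E, ContMDiffOn 𝓘(ℝ, E) (𝓘(ℝ, E).prod 𝓘(ℝ, E)) ∞
      (fun y => (⟨e.symm y, mfderiv 𝓘(ℝ, E) 𝓘(ℝ, E) e.symm y w⟩ : TangentBundle 𝓘(ℝ, E) M))
      e.target := by
    intro w
    have h1 := hs.contMDiffOn_tangentMapWithin (m := ∞) (by simp)
      e.open_target.uniqueMDiffOn
    have h2 : ContMDiff 𝓘(ℝ, E) (𝓘(ℝ, E).prod 𝓘(ℝ, E)) ∞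
        (fun y => (⟨y, w⟩ : TangentBundle 𝓘(ℝ, E) E)) := by
      intro y
      rw [contMDiffAt_totalSpace]
      refine ⟨contMDiffAt_id, ?_⟩
      simpa using contMDiffAt_const
    refine (h1.comp (t := _) h2.contMDiffOn fun y hy => hy).congr fun y hy => ?_
    simp only [Function.comp_apply]
    rw [tangentMapWithin_eq_tangentMap]
    · rfl
    · exact e.open_target.uniqueMDiffWithinAt hy
    · exact ((hs y hy).contMDiffAt (e.open_target.mem_nhds hy)).mdifferentiableAt (by simp)
  exact ContMDiffOn.inner_bundle (E := fun x : M => TangentSpace 𝓘(ℝ, E) x) (b := e.symm)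
    (v := fun y => mfderiv 𝓘(ℝ, E) 𝓘(ℝ, E) e.symm y u)
    (w := fun y => mfderiv 𝓘(ℝ, E) 𝓘(ℝ, E) e.symm y v) (key u) (key v)

variable [FiniteDimensional ℝ E]

lemma contDiffAt_chartMetricCLM {e : OpenPartialHomeomorph M E} (he : e ∈ atlas E M) {y : E}
    (hy : y ∈ e.target) : ContDiffAt ℝ ∞ (chartMetricCLM e) y := by
  have : ContDiffOn ℝ ∞ (chartMetricCLM e) e.target :=
    contDiffOn_clm_apply.2 fun u => contDiffOn_clm_apply.2 fun v => contDiffOn_chartMetric he u v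
  exact this.contDiffAt (e.open_target.mem_nhds hy)

/-- Diffeomorphisms that preserve the metric map geodesics to geodesics. -/
lemma IsGeodesicCurve.comp_isometry {γ : ℝ → M} (hγ : IsGeodesicCurve (E := E) γ) {f f' : M → M}
    (hf : ContMDiff 𝓘(ℝ, E) 𝓘(ℝ, E) ∞ f) (hf' : ContMDiff 𝓘(ℝ, E) 𝓘(ℝ, E) ∞ f')
    (hff' : ∀ x, f' (f x) = x) (hiso : PreservesRiemannianForm (E := E) f') :
    IsGeodesicCurve (E := E) (f ∘ γ) := by
  have hfγ : ContMDiff 𝓘(ℝ, ℝ) 𝓘(ℝ, E) ∞ (f ∘ γ) := hf.comp hγ.1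
  refine ⟨hfγ, fun e he t ht w => ?_⟩
  set e₀ := chartAt E (γ t) with he₀'
  have he₀ : e₀ ∈ atlas E M := chart_mem_atlas E (γ t)
  have hmem : γ t ∈ e₀.source := mem_chart_source E (γ t)
  have ht' : f (γ t) ∈ e.source := ht
  have hy : e (f (γ t)) ∈ e.target := e.map_source ht'
  have hback : f' (e.symm (e (f (γ t)))) = γ t := by rw [e.left_inv ht', hff']
  have hsymm : ContMDiffAt 𝓘(ℝ, E) 𝓘(ℝ, E) ∞ e.symm (e (f (γ t))) :=
    (contMDiffOn_symm_of_mem_maximalAtlas (IsManifold.subset_maximalAtlas he)).contMDiffAt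
      (e.open_target.mem_nhds hy)
  have hfs : ContMDiffAt 𝓘(ℝ, E) 𝓘(ℝ, E) ∞ (f' ∘ e.symm) (e (f (γ t))) :=
    ContMDiffAt.comp (e (f (γ t))) (hf' _) hsymm
  have hφ : ContDiffAt ℝ ∞ (fun z => e₀ (f' (e.symm z))) (e (f (γ t))) := by
    refine contMDiffAt_iff_contDiffAt.1 (ContMDiffAt.comp (g := e₀) (f := f' ∘ e.symm) _ ?_ hfs)
    refine contMDiffAt_of_mem_maximalAtlas (IsManifold.subset_maximalAtlas he₀) ?_
    simp only [Function.comp_apply, hback, hmem]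
  have hc : (fun s => e₀ (γ s)) =ᶠ[𝓝 t]
      (fun z => e₀ (f' (e.symm z))) ∘ (fun s => e (f (γ s))) := by
    have : ∀ᶠ s in 𝓝 t, f (γ s) ∈ e.source :=
      (hfγ t).continuousAt.eventually (e.open_source.mem_nhds ht')
    filter_upwards [this] with s hs
    simp only [Function.comp_apply]
    rw [e.left_inv hs, hff']
  -- The change of coordinates is `f'` read from `e` to `e₀`: it pulls the metric of `e₀` back to
  -- that of `e`, so the equation of `γ` in `e₀` yields that of `f ∘ γ` in `e`.
  refine geodesic_equation_of_pullback (κ := chartMetricCLM e₀) (κ' := chartMetricCLM e)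
    (φ := fun z => e₀ (f' (e.symm z))) (c := fun s => e₀ (γ s)) (c' := fun s => e (f (γ s)))
    (hφ.of_le (by norm_cast)) ?_ (fun u v => chartMetric_symm _ _ _ _) ?_
    ((contDiffAt_chart_comp_curve he hfγ ht).of_le (by norm_cast)) hc
    (hγ.2 e₀ he₀ t hmem) w
  · refine (contDiffAt_chartMetricCLM he₀ ?_).differentiableAt (by simp)
    rw [hback]
    exact e₀.map_source hmem
  · have h1 : ∀ᶠ z in 𝓝 (e (f (γ t))), f' (e.symm z) ∈ e₀.source := by
      refine hfs.continuousAt.eventually (e₀.open_source.mem_nhds ?_)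
      rwa [Function.comp_apply, hback]
    filter_upwards [h1, e.open_target.mem_nhds hy] with z hz hz' u v
    exact chartMetric_pullback hf' hiso he he₀ hz' hz u v

/-- Local uniqueness of geodesics. -/
lemma IsGeodesicCurve.eventuallyEq {γ₁ γ₂ : ℝ → M} (h₁ : IsGeodesicCurve (E := E) γ₁)
    (h₂ : IsGeodesicCurve (E := E) γ₂) {e : OpenPartialHomeomorph M E} (he : e ∈ atlas E M)
    {t : ℝ} (ht : γ₁ t ∈ e.source) (h0 : γ₁ t = γ₂ t)
    (hd : deriv (fun s => e (γ₁ s)) t = deriv (fun s => e (γ₂ s)) t) : γ₁ =ᶠ[𝓝 t] γ₂ := by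
  have ht₂ : γ₂ t ∈ e.source := h0 ▸ ht
  have hs₁ : ∀ᶠ s in 𝓝 t, γ₁ s ∈ e.source :=
    (h₁.1 t).continuousAt.eventually (e.open_source.mem_nhds ht)
  have hs₂ : ∀ᶠ s in 𝓝 t, γ₂ s ∈ e.source :=
    (h₂.1 t).continuousAt.eventually (e.open_source.mem_nhds ht₂)
  have key := geodesic_equation_unique (κ := chartMetricCLM e) (c₁ := fun s => e (γ₁ s))
    (c₂ := fun s => e (γ₂ s)) (t := t)
    ((contDiffAt_chartMetricCLM he (e.map_source ht)).of_le (by norm_cast))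
    (by
      filter_upwards [e.open_target.mem_nhds (e.map_source ht)] with z hz u hu
      exact eq_zero_of_chartMetric_self he hz hu)
    ((contDiffAt_chart_comp_curve he h₁.1 ht).of_le (by norm_cast))
    ((contDiffAt_chart_comp_curve he h₂.1 ht₂).of_le (by norm_cast))
    (congrArg e h0) hd
    (hs₁.mono fun s hs => h₁.2 e he s hs) (hs₂.mono fun s hs => h₂.2 e he s hs)
  filter_upwards [key, hs₁, hs₂] with s h h1 h2 using e.injOn h1 h2 h

/-- Uniqueness of geodesics. -/
theorem IsGeodesicCurve.eq_of_tangentMap_eq [T2Space M] {γ₁ γ₂ : ℝ → M}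
    (h₁ : IsGeodesicCurve (E := E) γ₁) (h₂ : IsGeodesicCurve (E := E) γ₂) {t₀ : ℝ}
    (h : tangentMap 𝓘(ℝ, ℝ) 𝓘(ℝ, E) γ₁ ⟨t₀, (1 : ℝ)⟩
      = tangentMap 𝓘(ℝ, ℝ) 𝓘(ℝ, E) γ₂ ⟨t₀, (1 : ℝ)⟩) : γ₁ = γ₂ := by
  -- The times at which the germs agree form a clopen set. At a limit time the positions and the
  -- chart velocities agree by continuity, and local uniqueness applies again.
  have hopen : IsOpen {t | γ₁ =ᶠ[𝓝 t] γ₂} := isOpen_setOfPred_eventually_nhds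
  have hclosed : IsClosed {t | γ₁ =ᶠ[𝓝 t] γ₂} := by
    rw [← closure_subset_iff_isClosed]
    intro t ht
    have heq : γ₁ t = γ₂ t := by
      have hc : IsClosed {s | γ₁ s = γ₂ s} := isClosed_eq h₁.1.continuous h₂.1.continuous
      exact hc.closure_subset_iff.2 (fun s hs => hs.self_of_nhds) ht
    set e := chartAt E (γ₁ t) with he'
    have he : e ∈ atlas E M := chart_mem_atlas E (γ₁ t)
    have hmem : γ₁ t ∈ e.source := mem_chart_source E (γ₁ t)
    refine h₁.eventuallyEq h₂ he hmem heq ?_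
    have hcont : ∀ γ : ℝ → M, IsGeodesicCurve (E := E) γ → γ t ∈ e.source →
        ContinuousAt (deriv (fun s => e (γ s))) t := by
      intro γ hγ hγt
      have := ((contDiffAt_chart_comp_curve he hγ.1 hγt).fderiv_right (m := 1)
        (by norm_cast)).continuousAt.clm_apply
        (continuousAt_const (y := (1 : ℝ)))
      simpa only [fderiv_apply_one_eq_deriv] using this
    have hfr : ∃ᶠ s in 𝓝 t, deriv (fun s => e (γ₁ s)) s = deriv (fun s => e (γ₂ s)) s := by
      refine (mem_closure_iff_frequently.1 ht).mono fun s hs => ?_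
      exact Filter.EventuallyEq.deriv_eq (hs.mono fun r hr => congrArg e hr)
    by_contra hne
    refine hfr ?_
    exact ((hcont γ₁ h₁ hmem).ne_iff_eventually_ne (hcont γ₂ h₂ (heq ▸ hmem))).1 hne
  have hmem : t₀ ∈ {t | γ₁ =ᶠ[𝓝 t] γ₂} := by
    have h0 : γ₁ t₀ = γ₂ t₀ := congrArg TotalSpace.proj h
    have hs : γ₁ t₀ ∈ (chartAt E (γ₁ t₀)).source := mem_chart_source E (γ₁ t₀)
    refine h₁.eventuallyEq h₂ (chart_mem_atlas E (γ₁ t₀)) hs h0 ?_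
    rw [deriv_chart_comp_curve (chart_mem_atlas E _) h₁.1 hs,
      deriv_chart_comp_curve (chart_mem_atlas E _) h₂.1 (h0 ▸ hs), h]
  have huniv := IsClopen.eq_univ ⟨hclosed, hopen⟩ ⟨t₀, hmem⟩
  funext t
  have : t ∈ {t | γ₁ =ᶠ[𝓝 t] γ₂} := huniv ▸ mem_univ t
  exact this.self_of_nhds

/-- Uniqueness makes the choice in the definition harmless: any geodesic with the right initial
velocity computes the exponential. -/
lemma riemannianExp_eq_of_isGeodesicCurve [T2Space M] {γ : ℝ → M}
    (hγ : IsGeodesicCurve (E := E) γ) {x : M} {v : TangentSpace 𝓘(ℝ, E) x}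
    (h0 : tangentMap 𝓘(ℝ, ℝ) 𝓘(ℝ, E) γ ⟨0, (1 : ℝ)⟩ = ⟨x, v⟩) :
    riemannianExp (E := E) x v = γ 1 := by
  have h : ∃ γ : ℝ → M, IsGeodesicCurve (E := E) γ ∧
      tangentMap 𝓘(ℝ, ℝ) 𝓘(ℝ, E) γ ⟨0, (1 : ℝ)⟩ = ⟨x, v⟩ := ⟨γ, hγ, h0⟩
  rw [riemannianExp, dif_pos h]
  rw [h.choose_spec.1.eq_of_tangentMap_eq hγ (h.choose_spec.2.trans h0.symm)]

/-- The exponential map commutes with isometries. -/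
theorem riemannianExp_isometry [T2Space M] {f f' : M → M}
    (hf : ContMDiff 𝓘(ℝ, E) 𝓘(ℝ, E) ∞ f) (hf' : ContMDiff 𝓘(ℝ, E) 𝓘(ℝ, E) ∞ f')
    (hff' : ∀ x, f' (f x) = x) (hf'f : ∀ x, f (f' x) = x)
    (hiso : PreservesRiemannianForm (E := E) f) (hiso' : PreservesRiemannianForm (E := E) f')
    (x : M) (v : TangentSpace 𝓘(ℝ, E) x) :
    riemannianExp (E := E) (f x) (mfderiv 𝓘(ℝ, E) 𝓘(ℝ, E) f x v)
      = f (riemannianExp (E := E) x v) := by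
  by_cases h : ∃ γ : ℝ → M, IsGeodesicCurve (E := E) γ ∧
      tangentMap 𝓘(ℝ, ℝ) 𝓘(ℝ, E) γ ⟨0, (1 : ℝ)⟩ = ⟨x, v⟩
  · obtain ⟨γ, hγ, h0⟩ := h
    rw [riemannianExp_eq_of_isGeodesicCurve hγ h0]
    refine riemannianExp_eq_of_isGeodesicCurve (hγ.comp_isometry hf hf' hff' hiso') ?_
    rw [tangentMap_comp_at _ ((hf _).mdifferentiableAt (by simp))
      ((hγ.1 _).mdifferentiableAt (by simp)), h0]
    rfl
  -- A geodesic issuing from the image vector would be carried back by `f'`. So both exponentials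
  -- take their default values, `f x` and `x`, which `f` also matches.
  · have h' : ¬ ∃ γ : ℝ → M, IsGeodesicCurve (E := E) γ ∧
        tangentMap 𝓘(ℝ, ℝ) 𝓘(ℝ, E) γ ⟨0, (1 : ℝ)⟩
          = ⟨f x, mfderiv 𝓘(ℝ, E) 𝓘(ℝ, E) f x v⟩ := by
      rintro ⟨γ, hγ, h0⟩
      refine h ⟨f' ∘ γ, hγ.comp_isometry hf' hf hf'f hiso, ?_⟩
      rw [tangentMap_comp_at _ ((hf' _).mdifferentiableAt (by simp))
        ((hγ.1 _).mdifferentiableAt (by simp)), h0]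
      have : tangentMap 𝓘(ℝ, E) 𝓘(ℝ, E) (f' ∘ f) ⟨x, v⟩ = ⟨x, v⟩ := by
        have hid : f' ∘ f = id := funext hff'
        rw [hid, tangentMap_id]
        rfl
      rw [tangentMap_comp_at _ ((hf' _).mdifferentiableAt (by simp))
        ((hf _).mdifferentiableAt (by simp))] at this
      exact this
    rw [riemannianExp, dif_neg h', riemannianExp, dif_neg h]

end Geodesics

/-! ### Equivariance of the gradient and of `exp ∇ψ`. -/

section Gradient

variable {E : Type*} [NormedAddCommGroup E] [NormedSpace ℝ E]
  {M : Type*} [TopologicalSpace M] [ChartedSpace E M]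
  [RiemannianBundle (fun x : M => TangentSpace 𝓘(ℝ, E) x)]

lemma eq_of_riemannianForm_eq {x : M} {u v : E}
    (h : ∀ w, riemannianForm (E := E) x u w = riemannianForm (E := E) x v w) : u = v :=
  ext_inner_right (E := TangentSpace 𝓘(ℝ, E) x) ℝ h

variable [FiniteDimensional ℝ E]

lemma riemannianForm_riemannianGradient (ψ : M → ℝ) (x : M) (w : E) :
    riemannianForm (E := E) x (riemannianGradient (E := E) ψ x) w
      = (mfderiv 𝓘(ℝ, E) 𝓘(ℝ, ℝ) ψ x w : ℝ) := by
  have : FiniteDimensional ℝ (TangentSpace 𝓘(ℝ, E) x) :=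
    inferInstanceAs (FiniteDimensional ℝ E)
  have : CompleteSpace (TangentSpace 𝓘(ℝ, E) x) := FiniteDimensional.complete ℝ _
  exact InnerProductSpace.toDual_symm_apply (𝕜 := ℝ) (E := TangentSpace 𝓘(ℝ, E) x)

/-- The gradient of a function that is locally invariant under an isometry is equivariant. -/
lemma riemannianGradient_isometry {f f' : M → M}
    (hf : ContMDiff 𝓘(ℝ, E) 𝓘(ℝ, E) ∞ f) (hf' : ContMDiff 𝓘(ℝ, E) 𝓘(ℝ, E) ∞ f')
    (hff' : ∀ x, f' (f x) = x) (hf'f : ∀ x, f (f' x) = x)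
    (hiso : PreservesRiemannianForm (E := E) f) {ψ : M → ℝ} {x : M}
    (hψ : ψ ∘ f =ᶠ[𝓝 x] ψ) :
    riemannianGradient (E := E) ψ (f x)
      = mfderiv 𝓘(ℝ, E) 𝓘(ℝ, E) f x (riemannianGradient (E := E) ψ x) := by
  have hfd : ∀ y, MDifferentiableAt 𝓘(ℝ, E) 𝓘(ℝ, E) f y := fun y =>
    (hf y).mdifferentiableAt (by simp)
  have hfd' : ∀ y, MDifferentiableAt 𝓘(ℝ, E) 𝓘(ℝ, E) f' y := fun y =>
    (hf' y).mdifferentiableAt (by simp)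
  have hdψ : ∀ w : E, (mfderiv 𝓘(ℝ, E) 𝓘(ℝ, ℝ) ψ (f x)
      (mfderiv 𝓘(ℝ, E) 𝓘(ℝ, E) f x w) : ℝ) = (mfderiv 𝓘(ℝ, E) 𝓘(ℝ, ℝ) ψ x w : ℝ) := by
    intro w
    by_cases hd : MDifferentiableAt 𝓘(ℝ, E) 𝓘(ℝ, ℝ) ψ (f x)
    · have h1 := mfderiv_comp_apply x hd (hfd x) w
      rw [hψ.mfderiv_eq] at h1
      exact h1.symm
    -- Differentiability at `x` and at `f x` are equivalent, so here both differentials have the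
    -- default value `0`.
    · have hd' : ¬ MDifferentiableAt 𝓘(ℝ, E) 𝓘(ℝ, ℝ) ψ x := by
        intro hx
        apply hd
        have h2 : MDifferentiableAt 𝓘(ℝ, E) 𝓘(ℝ, ℝ) (ψ ∘ f) x := hψ.mdifferentiableAt_iff.2 hx
        have h3 : MDifferentiableAt 𝓘(ℝ, E) 𝓘(ℝ, ℝ) ((ψ ∘ f) ∘ f') (f x) := by
          refine MDifferentiableAt.comp (f x) ?_ (hfd' _)
          rwa [hff']
        have h4 : (ψ ∘ f) ∘ f' = ψ := by
          funext y
          simp only [Function.comp_apply, hf'f]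
        rwa [h4] at h3
      rw [mfderiv_zero_of_not_mdifferentiableAt hd, mfderiv_zero_of_not_mdifferentiableAt hd']
      rfl
  have hsurj : ∀ w : E, ∃ w' : E, (mfderiv 𝓘(ℝ, E) 𝓘(ℝ, E) f x w' : E) = w := by
    intro w
    refine ⟨(mfderiv 𝓘(ℝ, E) 𝓘(ℝ, E) f' (f x) w : E), ?_⟩
    have h1 := mfderiv_comp_apply_of_eq (g := f) (f := f') (x := f x) (hfd x) (hfd' _) (hff' x) w
    have h2 : f ∘ f' = id := funext hf'f
    rw [h2, mfderiv_id] at h1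
    exact h1.symm
  refine eq_of_riemannianForm_eq (E := E) (x := f x) fun w => ?_
  obtain ⟨w', rfl⟩ := hsurj w
  refine (riemannianForm_riemannianGradient ψ (f x) _).trans ?_
  refine (hdψ w').trans ?_
  refine Eq.trans ?_ (hiso x (riemannianGradient (E := E) ψ x) w').symm
  exact (riemannianForm_riemannianGradient ψ x w').symm

/-- `T = exp ∇ψ` commutes with isometries that locally preserve `ψ`. -/
theorem expGradientMap_isometry [T2Space M] [IsManifold 𝓘(ℝ, E) ∞ M]
    [IsContMDiffRiemannianBundle 𝓘(ℝ, E) ∞ E (fun x : M => TangentSpace 𝓘(ℝ, E) x)]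
    {f f' : M → M}
    (hf : ContMDiff 𝓘(ℝ, E) 𝓘(ℝ, E) ∞ f) (hf' : ContMDiff 𝓘(ℝ, E) 𝓘(ℝ, E) ∞ f')
    (hff' : ∀ x, f' (f x) = x) (hf'f : ∀ x, f (f' x) = x)
    (hiso : PreservesRiemannianForm (E := E) f) (hiso' : PreservesRiemannianForm (E := E) f')
    {ψ : M → ℝ} {x : M} (hψ : ψ ∘ f =ᶠ[𝓝 x] ψ) :
    expGradientMap (E := E) ψ (f x) = f (expGradientMap (E := E) ψ x) := by
  rw [expGradientMap, riemannianGradient_isometry hf hf' hff' hf'f hiso hψ,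
    riemannianExp_isometry hf hf' hff' hf'f hiso hiso']
  rfl

end Gradient

/-! ### The action in charts, and openness of the saturation of the slice. -/

section Coordinates

variable {E : Type*} [NormedAddCommGroup E] [NormedSpace ℝ E]
  {E' : Type*} [NormedAddCommGroup E'] [NormedSpace ℝ E']
  {F : Type*} [NormedAddCommGroup F] [NormedSpace ℝ F]
  {M : Type*} [TopologicalSpace M] [ChartedSpace E M]
  {G : Type*} [TopologicalSpace G] [ChartedSpace E' G] [Group G]
  [MulAction G M]
  {S : Type*} [TopologicalSpace S] [ChartedSpace F S]

/-- Removes the transport along `1 • x = x` in the definition of the vertical space; it is invisible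
because every tangent space is a copy of `E`. -/
lemma exists_of_mem_verticalSpace {x : M} {v : E}
    (h : (v : TangentSpace 𝓘(ℝ, E) x) ∈ verticalSpace (E := E) (E' := E') G x) :
    ∃ u : E', (mfderiv 𝓘(ℝ, E') 𝓘(ℝ, E) (fun g : G => g • x) 1 u : E) = v := by
  have cast : ∀ {y x : M} (h : y = x)
      (L : TangentSpace 𝓘(ℝ, E') (1 : G) →L[ℝ] TangentSpace 𝓘(ℝ, E) y) (u : E'),
      ((h ▸ L : TangentSpace 𝓘(ℝ, E') (1 : G) →L[ℝ] TangentSpace 𝓘(ℝ, E) x) u : E)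
        = (L u : E) := by
    rintro y x rfl L u
    rfl
  obtain ⟨u, hu⟩ := h
  exact ⟨u, (cast (one_smul G x) _ u).symm.trans hu⟩

variable [ContMDiffSMul 𝓘(ℝ, E') 𝓘(ℝ, E) ∞ G M]

open IsManifold in
/-- The map `(g, s) ↦ g • ι s` is smooth in charts. -/
lemma contDiffAt_smul_in_charts {ι : S → M} (hι : ContMDiff 𝓘(ℝ, F) 𝓘(ℝ, E) ∞ ι)
    {eG : OpenPartialHomeomorph G E'} {eS : OpenPartialHomeomorph S F}
    {eM : OpenPartialHomeomorph M E} (hG : eG ∈ maximalAtlas 𝓘(ℝ, E') ∞ G)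
    (hS : eS ∈ maximalAtlas 𝓘(ℝ, F) ∞ S) (hM : eM ∈ maximalAtlas 𝓘(ℝ, E) ∞ M)
    {k : G} {s : S} (hk : k ∈ eG.source) (hs : s ∈ eS.source) (hks : k • ι s ∈ eM.source) :
    ContDiffAt ℝ ∞ (fun p : E' × F => eM (eG.symm p.1 • ι (eS.symm p.2))) (eG k, eS s) := by
  have h1 : ContMDiffAt 𝓘(ℝ, E' × F) 𝓘(ℝ, E') ∞ (fun p : E' × F => eG.symm p.1)
      (eG k, eS s) := by
    refine ContMDiffAt.comp (g := eG.symm) (I' := 𝓘(ℝ, E')) _ ?_ contDiff_fst.contMDiff.contMDiffAt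
    exact (contMDiffOn_symm_of_mem_maximalAtlas hG).contMDiffAt
      (eG.open_target.mem_nhds (eG.map_source hk))
  have h2 : ContMDiffAt 𝓘(ℝ, E' × F) 𝓘(ℝ, F) ∞ (fun p : E' × F => eS.symm p.2)
      (eG k, eS s) := by
    refine ContMDiffAt.comp (g := eS.symm) (I' := 𝓘(ℝ, F)) _ ?_ contDiff_snd.contMDiff.contMDiffAt
    exact (contMDiffOn_symm_of_mem_maximalAtlas hS).contMDiffAt
      (eS.open_target.mem_nhds (eS.map_source hs))
  have h3 : ContMDiffAt 𝓘(ℝ, E' × F) 𝓘(ℝ, E) ∞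
      (fun p : E' × F => eG.symm p.1 • ι (eS.symm p.2)) (eG k, eS s) :=
    h1.smul (ContMDiffAt.comp (g := ι) _ (hι _) h2)
  refine contMDiffAt_iff_contDiffAt.1 (ContMDiffAt.comp (g := eM) _ ?_ h3)
  refine contMDiffAt_of_mem_maximalAtlas hM ?_
  simpa only [eG.left_inv hk, eS.left_inv hs] using hks

open IsManifold in
lemma contDiffAt_in_charts {f : S → M} {eS : OpenPartialHomeomorph S F}
    {eM : OpenPartialHomeomorph M E} (hS : eS ∈ maximalAtlas 𝓘(ℝ, F) ∞ S)
    (hM : eM ∈ maximalAtlas 𝓘(ℝ, E) ∞ M) {s : S} (hf : ContMDiffAt 𝓘(ℝ, F) 𝓘(ℝ, E) ∞ f s)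
    (hs : s ∈ eS.source) (hfs : f s ∈ eM.source) :
    ContDiffAt ℝ ∞ (fun b : F => eM (f (eS.symm b))) (eS s) := by
  have h2 : ContMDiffAt 𝓘(ℝ, F) 𝓘(ℝ, F) ∞ eS.symm (eS s) :=
    (contMDiffOn_symm_of_mem_maximalAtlas hS).contMDiffAt
      (eS.open_target.mem_nhds (eS.map_source hs))
  have h3 : ContMDiffAt 𝓘(ℝ, F) 𝓘(ℝ, E) ∞ (fun b : F => f (eS.symm b)) (eS s) :=
    ContMDiffAt.comp_of_eq (g := f) (y := s) hf h2 (eS.left_inv hs)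
  refine contMDiffAt_iff_contDiffAt.1 (ContMDiffAt.comp (g := eM) _ ?_ h3)
  refine contMDiffAt_of_mem_maximalAtlas hM ?_
  simpa only [eS.left_inv hs] using hfs

open IsManifold in
lemma mdifferentiable_of_mem_maximalAtlas_infty {eS : OpenPartialHomeomorph S F}
    (hS : eS ∈ maximalAtlas 𝓘(ℝ, F) ∞ S) : eS.MDifferentiable 𝓘(ℝ, F) 𝓘(ℝ, F) :=
  ⟨(contMDiffOn_of_mem_maximalAtlas hS).mdifferentiableOn (by simp),
    (contMDiffOn_symm_of_mem_maximalAtlas hS).mdifferentiableOn (by simp)⟩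

open IsManifold in
lemma fderiv_in_charts {f : S → M} {eS : OpenPartialHomeomorph S F}
    {eM : OpenPartialHomeomorph M E} (hS : eS ∈ maximalAtlas 𝓘(ℝ, F) ∞ S)
    (hM : eM ∈ maximalAtlas 𝓘(ℝ, E) ∞ M) {s : S} (hf : MDifferentiableAt 𝓘(ℝ, F) 𝓘(ℝ, E) f s)
    (hs : s ∈ eS.source) (hfs : f s ∈ eM.source) (w : F) :
    (fderiv ℝ (fun b : F => eM (f (eS.symm b))) (eS s) w : E)
      = (mfderiv 𝓘(ℝ, E) 𝓘(ℝ, E) eM (f s) (mfderiv 𝓘(ℝ, F) 𝓘(ℝ, E) f s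
          (mfderiv 𝓘(ℝ, F) 𝓘(ℝ, F) eS.symm (eS s) w : F) : E) : E) := by
  have h1 : MDifferentiableAt 𝓘(ℝ, F) 𝓘(ℝ, F) eS.symm (eS s) :=
    (mdifferentiable_of_mem_maximalAtlas_infty hS).mdifferentiableAt_symm (eS.map_source hs)
  have h2 : MDifferentiableAt 𝓘(ℝ, E) 𝓘(ℝ, E) eM (f s) :=
    (mdifferentiable_of_mem_maximalAtlas_infty hM).mdifferentiableAt hfs
  have h3 : MDifferentiableAt 𝓘(ℝ, F) 𝓘(ℝ, E) (f ∘ eS.symm) (eS s) :=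
    MDifferentiableAt.comp (eS s) (by rwa [eS.left_inv hs]) h1
  have a := mfderiv_comp_apply_of_eq (g := eM) (f := f ∘ eS.symm) (x := eS s) (y := f s) h2 h3
    (congrArg f (eS.left_inv hs)) w
  have b := mfderiv_comp_apply_of_eq (g := f) (f := eS.symm) (x := eS s) (y := s) hf h1
    (eS.left_inv hs) w
  rw [← mfderiv_eq_fderiv]
  exact a.trans (congrArg (fun v : E => (mfderiv 𝓘(ℝ, E) 𝓘(ℝ, E) eM (f s) v : E)) b)

open IsManifold in
lemma exists_mfderiv_symm_eq {eS : OpenPartialHomeomorph S F}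
    (hS : eS ∈ maximalAtlas 𝓘(ℝ, F) ∞ S) {s : S} (hs : s ∈ eS.source) (w : F) :
    ∃ w' : F, (mfderiv 𝓘(ℝ, F) 𝓘(ℝ, F) eS.symm (eS s) w' : F) = w := by
  have h := (mdifferentiable_of_mem_maximalAtlas_infty hS).symm_comp_deriv hs
  exact ⟨(mfderiv 𝓘(ℝ, F) 𝓘(ℝ, F) eS s w : F), congrArg
    (fun L : TangentSpace 𝓘(ℝ, F) s →L[ℝ] TangentSpace 𝓘(ℝ, F) s => (L w : F)) h⟩

open IsManifold in
/-- If `T_{ι s} M` is spanned by the vertical vectors and by the vectors tangent to `Σ`, then `G·Σ`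
is a neighbourhood of `ι s`. -/
lemma saturation_mem_nhds [IsManifold 𝓘(ℝ, E) ∞ M] [IsManifold 𝓘(ℝ, E') ∞ G]
    [IsManifold 𝓘(ℝ, F) ∞ S] [FiniteDimensional ℝ E] [FiniteDimensional ℝ E']
    [FiniteDimensional ℝ F] {ι : S → M} (hι : ContMDiff 𝓘(ℝ, F) 𝓘(ℝ, E) ∞ ι) (s : S)
    (hsup : verticalSpace (E := E) (E' := E') G (ι s)
      ⊔ imageTangentSpace (E := E) (F := F) ι s = ⊤) :
    {y : M | ∃ g : G, ∃ x ∈ range ι, y = g • x} ∈ 𝓝 (ι s) := by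
  have : CompleteSpace E := FiniteDimensional.complete ℝ E
  have : CompleteSpace E' := FiniteDimensional.complete ℝ E'
  have : CompleteSpace F := FiniteDimensional.complete ℝ F
  set eG := chartAt E' (1 : G)
  set eS := chartAt F s
  set eM := chartAt E (ι s)
  have hG : eG ∈ maximalAtlas 𝓘(ℝ, E') ∞ G := chart_mem_maximalAtlas 1
  have hS : eS ∈ maximalAtlas 𝓘(ℝ, F) ∞ S := chart_mem_maximalAtlas s
  have hM : eM ∈ maximalAtlas 𝓘(ℝ, E) ∞ M := chart_mem_maximalAtlas (ι s)
  have h1 : (1 : G) ∈ eG.source := mem_chart_source E' 1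
  have hs : s ∈ eS.source := mem_chart_source F s
  have hx : ι s ∈ eM.source := mem_chart_source E (ι s)
  have hx' : (1 : G) • ι s ∈ eM.source := by rwa [one_smul]
  set H : E' × F → E := fun p => eM (eG.symm p.1 • ι (eS.symm p.2)) with hHdef
  have hH : ContDiffAt ℝ ∞ H (eG 1, eS s) := contDiffAt_smul_in_charts hι hG hS hM h1 hs hx'
  have hHs := hH.hasStrictFDerivAt (by simp)
  have hH0 : H (eG 1, eS s) = eM (ι s) := by
    simp only [hHdef, eG.left_inv h1, eS.left_inv hs, one_smul]
  set D := fderiv ℝ H (eG 1, eS s) with hD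
  have hdG : MDifferentiableAt 𝓘(ℝ, E') 𝓘(ℝ, E) (fun g : G => g • ι s) 1 := by
    have : ContMDiff 𝓘(ℝ, E') 𝓘(ℝ, E) ∞ (fun g : G => g • ι s) :=
      contMDiff_id.smul contMDiff_const
    exact (this 1).mdifferentiableAt (by simp)
  have hdι : MDifferentiableAt 𝓘(ℝ, F) 𝓘(ℝ, E) ι s := (hι s).mdifferentiableAt (by simp)
  have hDl : ∀ u : E', D (u, 0) = (mfderiv 𝓘(ℝ, E) 𝓘(ℝ, E) eM (ι s)
      (mfderiv 𝓘(ℝ, E') 𝓘(ℝ, E) (fun g : G => g • ι s) 1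
        (mfderiv 𝓘(ℝ, E') 𝓘(ℝ, E') eG.symm (eG 1) u : E') : E) : E) := by
    intro u
    have a := (HasFDerivAt.comp (g := H) (f := fun a : E' => (a, eS s)) (eG 1)
      hHs.hasFDerivAt (hasFDerivAt_prodMk_left (eG 1) (eS s))).fderiv
    have b := fderiv_in_charts hG hM hdG h1 hx' u
    have c : (fun a : E' => eM (eG.symm a • ι s)) = H ∘ fun a => (a, eS s) := by
      funext a
      simp only [hHdef, Function.comp_apply, eS.left_inv hs]
    rw [c, a] at b
    refine Eq.trans ?_ (b.trans (congrArg
      (fun y : M => (mfderiv 𝓘(ℝ, E) 𝓘(ℝ, E) eM y _ : E)) (one_smul G (ι s))))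
    rfl
  have hDr : ∀ w : F, D (0, w) = (mfderiv 𝓘(ℝ, E) 𝓘(ℝ, E) eM (ι s)
      (mfderiv 𝓘(ℝ, F) 𝓘(ℝ, E) ι s
        (mfderiv 𝓘(ℝ, F) 𝓘(ℝ, F) eS.symm (eS s) w : F) : E) : E) := by
    intro w
    have a := (HasFDerivAt.comp (g := H) (f := fun b : F => (eG 1, b)) (eS s)
      hHs.hasFDerivAt (hasFDerivAt_prodMk_right (eG 1) (eS s))).fderiv
    have b := fderiv_in_charts hS hM hdι hs hx w
    have c : (fun b : F => eM (ι (eS.symm b))) = H ∘ fun b => (eG 1, b) := by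
      funext b
      simp only [hHdef, Function.comp_apply, eG.left_inv h1, one_smul]
    rw [c, a] at b
    exact b
  -- The partial differentials of `H` have as images the vertical space and the tangent space of
  -- `Σ`, read in the chart `eM`; by hypothesis these span.
  have hsurj : (D : E' × F →ₗ[ℝ] E).range = ⊤ := by
    rw [LinearMap.range_eq_top]
    intro y
    obtain ⟨z, hz⟩ := (mdifferentiable_of_mem_maximalAtlas_infty hM).mfderiv_surjective hx y
    have hzmem : z ∈ verticalSpace (E := E) (E' := E') G (ι s)
        ⊔ imageTangentSpace (E := E) (F := F) ι s := hsup ▸ Submodule.mem_top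
    obtain ⟨v₁, hv₁, v₂, hv₂, rfl⟩ :=
      (Submodule.mem_sup (R := ℝ) (M := TangentSpace 𝓘(ℝ, E) (ι s))).1 hzmem
    obtain ⟨u₁, hu₁⟩ := exists_of_mem_verticalSpace (E := E) (E' := E') (G := G) hv₁
    obtain ⟨w₂, hw₂⟩ := hv₂
    obtain ⟨u, rfl⟩ := exists_mfderiv_symm_eq hG h1 u₁
    obtain ⟨w, rfl⟩ := exists_mfderiv_symm_eq hS hs w₂
    refine ⟨(u, w), ?_⟩
    have h2 : D (u, w) = D (u, 0) + D (0, w) := by rw [← map_add]; simp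
    refine h2.trans ?_
    rw [hDl, hDr, ← hz, ← hw₂]
    erw [map_add, hu₁]
    rfl
  -- A strict derivative that is onto makes `H` open at the point, so `G·Σ` contains the images of
  -- neighbourhoods of `(1, s)`.
  have hmap := hHs.map_nhds_eq_of_surj hsurj
  rw [hH0] at hmap
  have hsymm : map eM.symm (𝓝 (eM (ι s))) = 𝓝 (ι s) := by
    have := eM.symm.map_nhds_eq (eM.map_source hx)
    rwa [eM.left_inv hx] at this
  rw [← hsymm, ← hmap]
  have hc : Tendsto (fun p : E' × F => eG.symm p.1 • ι (eS.symm p.2)) (𝓝 (eG 1, eS s))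
      (𝓝 (ι s)) := by
    have : ContinuousSMul G M := ContMDiffSMul.continuousSMul (I := 𝓘(ℝ, E')) (I' := 𝓘(ℝ, E)) ∞
    have a := (eG.continuousAt_symm (eG.map_source h1)).tendsto
    have b := (eS.continuousAt_symm (eS.map_source hs)).tendsto
    rw [eG.left_inv h1] at a
    rw [eS.left_inv hs] at b
    have c := (a.comp (tendsto_fst (f := 𝓝 (eG 1)) (g := 𝓝 (eS s)))).smul
      (((hι s).continuousAt.tendsto.comp b).comp (tendsto_snd (f := 𝓝 (eG 1)) (g := 𝓝 (eS s))))
    rw [one_smul, ← nhds_prod_eq] at c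
    exact c
  simp only [mem_map]
  filter_upwards [hc (eM.open_source.mem_nhds hx)] with p hp
  refine ⟨eG.symm p.1, ι (eS.symm p.2), mem_range_self _, ?_⟩
  exact eM.left_inv hp

end Coordinates

/-! ### Orbits and isotropy groups of proper actions. -/

section ProperAction

variable {G : Type*} [TopologicalSpace G] [Group G] {M : Type*} [TopologicalSpace M]
  [MulAction G M] [ProperSMul G M]

/-- The proper map `(g, y) ↦ (g • y, y)` is closed; restrict it to the slice `y = x`. -/
lemma isClosedMap_smul_const [T1Space M] (x : M) : IsClosedMap (fun g : G => g • x) := by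
  intro C hC
  have h := (ProperSMul.isProperMap_smul_pair (G := G) (X := M)).isClosedMap (C ×ˢ {x})
    (hC.prod isClosed_singleton)
  have h2 : (fun g : G => g • x) '' C
      = (fun y : M => (y, x)) ⁻¹' ((fun gx : G × M => (gx.1 • gx.2, gx.2)) '' (C ×ˢ {x})) := by
    ext y
    simp only [mem_image, mem_preimage, mem_prod, mem_singleton_iff, Prod.exists, Prod.mk.injEq]
    constructor
    · rintro ⟨g, hg, rfl⟩
      exact ⟨g, x, ⟨hg, rfl⟩, rfl, rfl⟩
    · rintro ⟨g, z, ⟨hg, rfl⟩, rfl, -⟩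
      exact ⟨g, hg, rfl⟩
  rw [h2]
  exact h.preimage (by fun_prop)

lemma isClosed_orbit [T1Space M] (x : M) : IsClosed (MulAction.orbit G x) := by
  have := isClosedMap_smul_const (G := G) x univ isClosed_univ
  rwa [image_univ] at this

/-- It is the first projection of the compact fibre of `(g, y) ↦ (g • y, y)` over `(x, x)`. -/
lemma isCompact_stabilizer [T1Space M] (x : M) :
    IsCompact (MulAction.stabilizer G x : Set G) := by
  have h := (ProperSMul.isProperMap_smul_pair (G := G) (X := M)).isCompact_preimage
    (isCompact_singleton (x := (x, x)))
  convert h.image continuous_fst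
  ext g
  simp only [SetLike.mem_coe, MulAction.mem_stabilizer_iff, mem_image, mem_preimage,
    mem_singleton_iff, Prod.exists, Prod.mk.injEq]
  constructor
  · intro hg
    exact ⟨g, x, ⟨hg, rfl⟩, rfl⟩
  · rintro ⟨g', y, ⟨h1, rfl⟩, rfl⟩
    exact h1

/-- An equivariant map is continuous on each orbit of a proper action. -/
lemma continuousOn_orbit_of_equivariant [T1Space M] {Φ : M → M} {a b : M}
    (h : ∀ g : G, Φ (g • a) = g • b) : ContinuousOn Φ (MulAction.orbit G a) := by
  rw [continuousOn_iff_isClosed]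
  intro C hC
  -- On the orbit, the preimage of `C` is obtained by pulling `C` back to `G` through `b` and
  -- pushing it forward by the closed orbit map of `a`.
  refine ⟨(fun g : G => g • a) '' ((fun g : G => g • b) ⁻¹' C),
    isClosedMap_smul_const a _ (hC.preimage (by fun_prop)), ?_⟩
  ext y
  constructor
  · rintro ⟨hy, g, rfl⟩
    exact ⟨⟨g, by simpa only [mem_preimage, h] using hy, rfl⟩, g, rfl⟩
  · rintro ⟨⟨g, hg, rfl⟩, hy⟩
    exact ⟨by simpa only [mem_preimage, h] using hg, hy⟩

end ProperAction

/-! ### Transport of the weighted orbit measures. -/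

section Transport

/-- Two choices of the group element differ by an element of the isotropy group of `x₀`, which fixes
`x`. -/
lemma orbitTransfer_smul {G : Type*} [Group G] {M : Type*} [MulAction G M] {x₀ x : M}
    (h : MulAction.stabilizer G x₀ ≤ MulAction.stabilizer G x) (g : G) :
    orbitTransfer G x₀ x (g • x₀) = g • x := by
  have hex : ∃ k : G, k • x₀ = g • x₀ := ⟨g, rfl⟩
  rw [orbitTransfer, dif_pos hex]
  have h1 : g⁻¹ * hex.choose ∈ MulAction.stabilizer G x := by
    apply h
    rw [MulAction.mem_stabilizer_iff, mul_smul, hex.choose_spec, inv_smul_smul]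
  rw [MulAction.mem_stabilizer_iff, mul_smul] at h1
  rw [inv_smul_eq_iff.1 h1]

lemma withDensity_map_eq {X Y : Type*} [MeasurableSpace X] [MeasurableSpace Y] {ν : Measure X}
    {f : X → Y} (hf : AEMeasurable f ν) {ρ : Y → ℝ≥0∞} (hρ : Measurable ρ) :
    (ν.map f).withDensity ρ = (ν.withDensity (ρ ∘ f)).map f := by
  have hf' : AEMeasurable f (ν.withDensity (ρ ∘ f)) :=
    hf.mono_ac (withDensity_absolutelyContinuous _ _)
  ext A hA
  rw [withDensity_apply _ hA, Measure.restrict_map_of_aemeasurable hf hA,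
    lintegral_map' hρ.aemeasurable hf.restrict, Measure.map_apply_of_aemeasurable hf' hA,
    withDensity_apply₀ _ (hf.nullMeasurableSet_preimage hA)]
  rfl

variable {E : Type*} [NormedAddCommGroup E] [NormedSpace ℝ E]
  {E' : Type*} [NormedAddCommGroup E'] [NormedSpace ℝ E']
  {M : Type*} [EMetricSpace M] [MeasurableSpace M] [BorelSpace M] [ChartedSpace E M]
  {G : Type*} [TopologicalSpace G] [ChartedSpace E' G] [Group G] [MulAction G M] [ProperSMul G M]

/-- Both measures are pushforwards from the reference orbit `G·x₀`: the pulled-back weights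
coincide, and `T` composed with one transfer map is the other, almost everywhere for the orbit
volume. -/
lemma isTransportMap_conditionalMeasure {x₀ x x' : M} {ρ : M → ℝ≥0∞} (hρ : Measurable ρ)
    (hx : MulAction.stabilizer G x₀ ≤ MulAction.stabilizer G x)
    (hx' : MulAction.stabilizer G x₀ ≤ MulAction.stabilizer G x')
    (hhor : ∀ g : G, ρ (g • x) = ρ (g • x')) {T : M → M} (hT : ∀ g : G, T (g • x) = g • x') :
    IsTransportMap T (conditionalMeasure (E := E) (E' := E') G x₀ ρ x)
      (conditionalMeasure (E := E) (E' := E') G x₀ ρ x') := by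
  set ν := orbitVol (E := E) (E' := E') G x₀ with hν
  have horb : ∀ a : M, MeasurableSet (MulAction.orbit G a) := fun a =>
    (isClosed_orbit a).measurableSet
  have hmem : ∀ᵐ y ∂ν, y ∈ MulAction.orbit G x₀ := ae_restrict_mem (horb x₀)
  have htr : ∀ a : M, MulAction.stabilizer G x₀ ≤ MulAction.stabilizer G a →
      AEMeasurable (orbitTransfer G x₀ a) ν := fun a ha =>
    (continuousOn_orbit_of_equivariant (orbitTransfer_smul ha)).aemeasurable (horb x₀)
  have hw : ∀ a : M, MulAction.stabilizer G x₀ ≤ MulAction.stabilizer G a →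
      weightedOrbitVol (E := E) (E' := E') G x₀ ρ a
        = (ν.withDensity (ρ ∘ orbitTransfer G x₀ a)).map (orbitTransfer G x₀ a) := fun a ha =>
    withDensity_map_eq (htr a ha) hρ
  have hr : ν.withDensity (ρ ∘ orbitTransfer G x₀ x)
      = ν.withDensity (ρ ∘ orbitTransfer G x₀ x') := by
    refine withDensity_congr_ae ?_
    filter_upwards [hmem] with y hy
    obtain ⟨g, rfl⟩ := hy
    simp only [Function.comp_apply, orbitTransfer_smul hx, orbitTransfer_smul hx', hhor]
  have hcarrier : ∀ a : M, MulAction.stabilizer G x₀ ≤ MulAction.stabilizer G a →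
      ∀ᵐ y ∂(weightedOrbitVol (E := E) (E' := E') G x₀ ρ a), y ∈ MulAction.orbit G a := by
    intro a ha
    rw [hw a ha]
    refine (ae_map_iff (p := fun y => y ∈ MulAction.orbit G a)
      ((htr a ha).mono_ac (withDensity_absolutelyContinuous _ _)) (horb a)).2 ?_
    refine (withDensity_absolutelyContinuous _ _).ae_le ?_
    filter_upwards [hmem] with y hy
    obtain ⟨g, rfl⟩ := hy
    simp only [orbitTransfer_smul ha]
    exact MulAction.mem_orbit a g
  -- The measure lives on the closed orbit of `x`, where an equivariant map is continuous; nothing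
  -- is asked of `T` elsewhere.
  have hTw : AEMeasurable T (weightedOrbitVol (E := E) (E' := E') G x₀ ρ x) := by
    rw [← Measure.restrict_eq_self_of_ae_mem (hcarrier x hx)]
    exact (continuousOn_orbit_of_equivariant hT).aemeasurable (horb x)
  have hmap : (weightedOrbitVol (E := E) (E' := E') G x₀ ρ x).map T
      = weightedOrbitVol (E := E) (E' := E') G x₀ ρ x' := by
    have hTw' := hTw
    rw [hw x hx] at hTw' ⊢
    rw [hw x' hx', AEMeasurable.map_map_of_aemeasurable hTw'
      ((htr x hx).mono_ac (withDensity_absolutelyContinuous _ _)), hr]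
    refine Measure.map_congr ?_
    refine (withDensity_absolutelyContinuous _ _).ae_le ?_
    filter_upwards [hmem] with y hy
    obtain ⟨g, rfl⟩ := hy
    simp only [Function.comp_apply, orbitTransfer_smul hx, orbitTransfer_smul hx', hT]
  have hmass : weightedOrbitVol (E := E) (E' := E') G x₀ ρ x (MulAction.orbit G x)
      = weightedOrbitVol (E := E) (E' := E') G x₀ ρ x' (MulAction.orbit G x') := by
    have h1 : ∀ a : M, MulAction.stabilizer G x₀ ≤ MulAction.stabilizer G a →
        weightedOrbitVol (E := E) (E' := E') G x₀ ρ a (MulAction.orbit G a)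
          = weightedOrbitVol (E := E) (E' := E') G x₀ ρ a univ := by
      intro a ha
      refine measure_congr ?_
      filter_upwards [hcarrier a ha] with y hy
      exact propext ⟨fun _ => trivial, fun _ => hy⟩
    rw [h1 x hx, h1 x' hx', ← hmap, Measure.map_apply_of_aemeasurable hTw MeasurableSet.univ,
      preimage_univ]
  refine ⟨hTw.smul_measure _, ?_⟩
  -- The two normalizing factors are equal as extended reals, so masses `0` and `∞` need no separate
  -- case.
  rw [conditionalMeasure, conditionalMeasure, Measure.map_smul, hmap, hmass]

end Transport

/-! ### The isotropy group of a principal point fixes the slice. -/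

section FixedPoints

open IsManifold

variable {E : Type*} [NormedAddCommGroup E] [NormedSpace ℝ E]
  {E' : Type*} [NormedAddCommGroup E'] [NormedSpace ℝ E']
  {F : Type*} [NormedAddCommGroup F] [NormedSpace ℝ F]
  {M : Type*} [TopologicalSpace M] [ChartedSpace E M]
  {G : Type*} [TopologicalSpace G] [ChartedSpace E' G] [Group G]
  [MulAction G M]
  {S : Type*} [TopologicalSpace S] [ChartedSpace F S]

/-- An immersion is the inclusion of a linear subspace in suitable charts. -/
lemma IsImmersionAt.exists_charts {ι : S → M} {s : S}
    (h : IsImmersionAt 𝓘(ℝ, F) 𝓘(ℝ, E) ∞ ι s) :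
    ∃ eS ∈ maximalAtlas 𝓘(ℝ, F) ∞ S, ∃ eM ∈ maximalAtlas 𝓘(ℝ, E) ∞ M,
      s ∈ eS.source ∧ ι s ∈ eM.source ∧ ∃ L : F →L[ℝ] E, (∃ c > 0, ∀ w, c * ‖w‖ ≤ ‖L w‖) ∧
        ∀ b ∈ eS.target, eM (ι (eS.symm b)) = L b := by
  refine ⟨h.domChart, h.domChart_mem_maximalAtlas, h.codChart, h.codChart_mem_maximalAtlas,
    h.mem_domChart_source, h.mem_codChart_source,
    (h.equiv : F × h.complement →L[ℝ] E).comp (ContinuousLinearMap.inl ℝ F h.complement), ?_, ?_⟩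
  · set A : E →L[ℝ] F × h.complement := (h.equiv.symm : E →L[ℝ] F × h.complement) with hA
    have hpos : 0 < ‖A‖ + 1 := by positivity
    -- `A` is a left inverse of the inclusion up to the zero component, so its norm gives the lower
    -- bound; the `+ 1` keeps the constant positive even if `A = 0`.
    refine ⟨(‖A‖ + 1)⁻¹, inv_pos.2 hpos, fun w => ?_⟩
    have h1 : A (h.equiv (w, 0)) = (w, 0) := h.equiv.symm_apply_apply _
    have h2 : ‖w‖ ≤ ‖A‖ * ‖h.equiv (w, 0)‖ := by
      have := A.le_opNorm (h.equiv (w, 0))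
      rw [h1] at this
      exact (le_max_left ‖w‖ _).trans this
    rw [inv_mul_le_iff₀ hpos]
    have h3 : 0 ≤ ‖h.equiv (w, 0)‖ := norm_nonneg _
    change ‖w‖ ≤ (‖A‖ + 1) * ‖h.equiv (w, 0)‖
    linarith
  · intro b hb
    have hb' : b ∈ (h.domChart.extend 𝓘(ℝ, F)).target := by simpa using hb
    exact h.writtenInCharts hb'

/-- If the elements of a compact group `Z` fix `ι s` and have the same first-order behaviour as the
identity along `ι` there, then they fix `ι` near `s`. -/
lemma eventually_smul_eq_of_fderiv_eq [ContMDiffSMul 𝓘(ℝ, E') 𝓘(ℝ, E) ∞ G M]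
    [IsManifold 𝓘(ℝ, E') ∞ G] {ι : S → M}
    (hι : IsSmoothEmbedding 𝓘(ℝ, F) 𝓘(ℝ, E) ∞ ι) {Z : Subgroup G}
    (hZ : IsCompact (Z : Set G)) (hinv : ∀ g ∈ Z, ∀ x ∈ range ι, g • x ∈ range ι) {s : S}
    (hfix : ∀ g ∈ Z, g • ι s = ι s)
    (hD : ∀ g ∈ Z, ∀ eM ∈ maximalAtlas 𝓘(ℝ, E) ∞ M, ∀ eS ∈ maximalAtlas 𝓘(ℝ, F) ∞ S,
      ι s ∈ eM.source → s ∈ eS.source →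
      fderiv ℝ (fun b : F => eM (g • ι (eS.symm b))) (eS s)
        = fderiv ℝ (fun b : F => eM (ι (eS.symm b))) (eS s)) :
    ∀ᶠ s' in 𝓝 s, ∀ g ∈ Z, g • ι s' = ι s' := by
  have : ContinuousSMul G M := ContMDiffSMul.continuousSMul (I := 𝓘(ℝ, E')) (I' := 𝓘(ℝ, E)) ∞
  have hιc : Continuous ι := hι.isEmbedding.continuous
  obtain ⟨eS, hS, eM, hM, hs, hx, L, ⟨c, hc, hL⟩, hwr⟩ :=
    IsImmersionAt.exists_charts (hι.isImmersion.isImmersionAt s)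
  have hdL : fderiv ℝ (fun b : F => eM (ι (eS.symm b))) (eS s) = L := by
    have : (fun b : F => eM (ι (eS.symm b))) =ᶠ[𝓝 (eS s)] L := by
      filter_upwards [eS.open_target.mem_nhds (eS.map_source hs)] with b hb using hwr b hb
    rw [this.fderiv_eq, L.fderiv]
  -- uniform first-order estimate
  have hest : ∀ᶠ q : S × S in 𝓝 (s, s), ∀ k ∈ (Z : Set G),
      ‖eM (k • ι q.1) - eM (k • ι q.2) - L (eS q.1 - eS q.2)‖ ≤ c / 2 * ‖eS q.1 - eS q.2‖ := by
    refine hZ.eventually_forall_of_forall_eventually fun k hk => ?_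
    set eG := chartAt E' k
    have hG : eG ∈ maximalAtlas 𝓘(ℝ, E') ∞ G := chart_mem_maximalAtlas k
    have hks : k ∈ eG.source := mem_chart_source E' k
    have hkx : k • ι s ∈ eM.source := by rwa [hfix k hk]
    set H : E' × F → E := fun p => eM (eG.symm p.1 • ι (eS.symm p.2)) with hHdef
    have hHs := (contDiffAt_smul_in_charts (eG := eG) hι.contMDiff hG hS hM hks hs
      hkx).hasStrictFDerivAt (by simp)
    have hD0 : ∀ w : F, fderiv ℝ H (eG k, eS s) (0, w) = L w := by
      intro w
      have a := (HasFDerivAt.comp (g := H) (f := fun b : F => (eG k, b)) (eS s)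
        hHs.hasFDerivAt (hasFDerivAt_prodMk_right (eG k) (eS s))).fderiv
      have b := hD k hk eM hM eS hS hx hs
      have e : (fun b : F => eM (k • ι (eS.symm b))) = H ∘ fun b => (eG k, b) := by
        funext b
        simp only [hHdef, Function.comp_apply, eG.left_inv hks]
      rw [e, a, hdL] at b
      exact congrArg (fun T : F →L[ℝ] E => T w) b
    have hlo := hHs.isLittleO.def (half_pos hc)
    have ht : Tendsto (fun z : (S × S) × G => (((eG z.2, eS z.1.1), (eG z.2, eS z.1.2)) :
        (E' × F) × (E' × F))) (𝓝 ((s, s), k)) (𝓝 ((eG k, eS s), (eG k, eS s))) := by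
      have a : Tendsto (fun z : (S × S) × G => eG z.2) (𝓝 ((s, s), k)) (𝓝 (eG k)) :=
        (eG.continuousAt hks).tendsto.comp (continuous_snd.tendsto _)
      have b1 : Tendsto (fun z : (S × S) × G => eS z.1.1) (𝓝 ((s, s), k)) (𝓝 (eS s)) :=
        (eS.continuousAt hs).tendsto.comp
          ((continuous_fst.comp continuous_fst).tendsto ((s, s), k))
      have b2 : Tendsto (fun z : (S × S) × G => eS z.1.2) (𝓝 ((s, s), k)) (𝓝 (eS s)) :=
        (eS.continuousAt hs).tendsto.comp
          ((continuous_snd.comp continuous_fst).tendsto ((s, s), k))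
      exact (a.prodMk_nhds b1).prodMk_nhds (a.prodMk_nhds b2)
    have hsrc : ∀ᶠ z : (S × S) × G in 𝓝 ((s, s), k),
        z.2 ∈ eG.source ∧ z.1.1 ∈ eS.source ∧ z.1.2 ∈ eS.source :=
      ((eG.open_source.preimage continuous_snd).eventually_mem hks).and
        (((eS.open_source.preimage (continuous_fst.comp continuous_fst)).eventually_mem hs).and
        ((eS.open_source.preimage (continuous_snd.comp continuous_fst)).eventually_mem hs))
    filter_upwards [ht.eventually hlo, hsrc] with z hz hz'
    obtain ⟨z1, z2, z3⟩ := hz'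
    rw [← hD0]
    simpa [hHdef, eG.left_inv z1, eS.left_inv z2, eS.left_inv z3] using hz
  rw [nhds_prod_eq] at hest
  obtain ⟨W, hW, hWest⟩ := eventually_prod_self_iff'.1 hest
  have hW' : W ∩ eS.source ∈ 𝓝 s := inter_mem hW (eS.open_source.mem_nhds hs)
  have hact : ∀ k : G, Tendsto (fun z : S × G => z.2 • ι z.1) (𝓝 (s, k)) (𝓝 (k • ι s)) :=
    fun k => (continuous_snd.smul (hιc.comp continuous_fst)).tendsto (s, k)
  have hbound : ∀ᶠ s' in 𝓝 s, ∀ k ∈ (Z : Set G), ‖eM (k • ι s')‖ ≤ ‖eM (ι s)‖ + 1 := by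
    refine hZ.eventually_forall_of_forall_eventually (P := fun s' k => ‖eM (k • ι s')‖ ≤ _)
      fun k hk => ?_
    have h1 := hact k
    rw [hfix k hk] at h1
    have h2 := ((eM.continuousAt hx).tendsto.comp h1).norm
    exact (h2.eventually (gt_mem_nhds (lt_add_one _))).mono fun _ h => h.le
  -- Since `ι` is a topological embedding, a moved point close to `ι s` in `M` has its parameter
  -- close to `s` in `S`.
  have hsmall : ∀ᶠ s' in 𝓝 s, ∀ k ∈ (Z : Set G), ∀ t, ι t = k • ι s' → t ∈ W ∩ eS.source := by
    refine hZ.eventually_forall_of_forall_eventually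
      (P := fun s' k => ∀ t, ι t = k • ι s' → t ∈ W ∩ eS.source) fun k hk => ?_
    rw [hι.isEmbedding.nhds_eq_comap, mem_comap] at hW'
    obtain ⟨U, hU, hUW⟩ := hW'
    have h1 := hact k
    rw [hfix k hk] at h1
    filter_upwards [h1 hU] with z hz t ht
    exact hUW (show ι t ∈ U from ht ▸ hz)
  filter_upwards [hW, hbound, hsmall, eS.open_source.mem_nhds hs] with s₁ h₁ hb hsm hs₁ g hg
  obtain ⟨s₂, hs₂⟩ := hinv g hg (ι s₁) (mem_range_self _)
  obtain ⟨hs₂W, hs₂S⟩ : s₂ ∈ W ∩ eS.source := hsm g hg s₂ hs₂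
  set d := eS s₂ - eS s₁ with hd
  -- Since `g • ι s₁ = ι s₂`, the estimate for `g ^ n` at the pair `(s₂, s₁)` controls the step from
  -- `g ^ n` to `g ^ (n + 1)`: each step is `L d` up to `c / 2 * ‖d‖`. The errors add up.
  have htel : ∀ n : ℕ, ‖eM (g ^ n • ι s₁) - eM (ι s₁) - (n : ℝ) • L d‖
      ≤ n * (c / 2 * ‖d‖) := by
    intro n
    induction n with
    | zero => simp
    | succ n ih =>
      have h1 := hWest s₂ hs₂W s₁ h₁ (g ^ n) (pow_mem hg n)
      simp only [hs₂] at h1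
      rw [smul_smul, ← pow_succ, ← hd] at h1
      have e : eM (g ^ (n + 1) • ι s₁) - eM (ι s₁) - ((n + 1 : ℕ) : ℝ) • L d
          = (eM (g ^ (n + 1) • ι s₁) - eM (g ^ n • ι s₁) - L d)
            + (eM (g ^ n • ι s₁) - eM (ι s₁) - (n : ℝ) • L d) := by
        push_cast
        module
      rw [e]
      refine (norm_add_le _ _).trans ((add_le_add h1 ih).trans (le_of_eq ?_))
      push_cast
      ring
  have hd0 : d = 0 := by
    by_contra hne
    have hdpos : 0 < c / 2 * ‖d‖ := mul_pos (half_pos hc) (norm_pos_iff.2 hne)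
    -- The drift `n • L d` has norm at least `n * c * ‖d‖`, of which the error absorbs only half.
    -- The remainder is at most twice the uniform bound on the orbit, which fails for this `n`.
    obtain ⟨n, hn⟩ := exists_nat_gt ((2 * (‖eM (ι s)‖ + 1)) / (c / 2 * ‖d‖))
    rw [div_lt_iff₀ hdpos] at hn
    have b1 := hb (g ^ n) (pow_mem hg n)
    have b2 := hb 1 (one_mem Z)
    rw [one_smul] at b2
    have b3 : ‖(n : ℝ) • L d‖ ≤ ‖eM (g ^ n • ι s₁)‖ + ‖eM (ι s₁)‖
        + ‖eM (g ^ n • ι s₁) - eM (ι s₁) - (n : ℝ) • L d‖ := by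
      have e : (n : ℝ) • L d = eM (g ^ n • ι s₁) - eM (ι s₁)
          - (eM (g ^ n • ι s₁) - eM (ι s₁) - (n : ℝ) • L d) := by abel
      calc ‖(n : ℝ) • L d‖ = ‖eM (g ^ n • ι s₁) - eM (ι s₁)
          - (eM (g ^ n • ι s₁) - eM (ι s₁) - (n : ℝ) • L d)‖ := by rw [← e]
        _ ≤ _ := (norm_sub_le _ _).trans (by gcongr; exact norm_sub_le _ _)
    rw [norm_smul, Real.norm_natCast] at b3
    have b4 := mul_le_mul_of_nonneg_left (hL d) (Nat.cast_nonneg (α := ℝ) n)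
    have b5 := htel n
    nlinarith
  have heq : s₂ = s₁ := eS.injOn hs₂S hs₁ (sub_eq_zero.1 hd0)
  rw [← hs₂, heq]

/-- A compact group that preserves a connected embedded submanifold and acts as the identity to first
order at one of its points fixes the submanifold pointwise. -/
theorem smul_eq_of_fderiv_eq [T2Space M] [ContMDiffSMul 𝓘(ℝ, E') 𝓘(ℝ, E) ∞ G M]
    [IsManifold 𝓘(ℝ, E) ∞ M] [IsManifold 𝓘(ℝ, E') ∞ G] [IsManifold 𝓘(ℝ, F) ∞ S]
    [ConnectedSpace S] {ι : S → M}
    (hι : IsSmoothEmbedding 𝓘(ℝ, F) 𝓘(ℝ, E) ∞ ι) {Z : Subgroup G}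
    (hZ : IsCompact (Z : Set G)) (hinv : ∀ g ∈ Z, ∀ x ∈ range ι, g • x ∈ range ι) {s₀ : S}
    (hfix : ∀ g ∈ Z, g • ι s₀ = ι s₀)
    (hD : ∀ g ∈ Z, ∀ eM ∈ maximalAtlas 𝓘(ℝ, E) ∞ M, ∀ eS ∈ maximalAtlas 𝓘(ℝ, F) ∞ S,
      ι s₀ ∈ eM.source → s₀ ∈ eS.source →
      fderiv ℝ (fun b : F => eM (g • ι (eS.symm b))) (eS s₀)
        = fderiv ℝ (fun b : F => eM (ι (eS.symm b))) (eS s₀)) (s : S) :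
    ∀ g ∈ Z, g • ι s = ι s := by
  have : ContinuousSMul G M := ContMDiffSMul.continuousSMul (I := 𝓘(ℝ, E')) (I' := 𝓘(ℝ, E)) ∞
  have hιc : Continuous ι := hι.isEmbedding.continuous
  set A : Set S := {s | ∀ᶠ s' in 𝓝 s, ∀ g ∈ Z, g • ι s' = ι s'} with hA
  have hopen : IsOpen A := isOpen_setOfPred_eventually_nhds
  have hclosed : IsClosed A := by
    rw [← closure_subset_iff_isClosed]
    intro t ht
    have hfixt : ∀ g ∈ Z, g • ι t = ι t := by
      intro g hg
      have hc : IsClosed {s | g • ι s = ι s} := isClosed_eq (by fun_prop) hιc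
      exact hc.closure_subset_iff.2 (fun s hs => hs.self_of_nhds g hg) ht
    refine eventually_smul_eq_of_fderiv_eq (E' := E') hι hZ hinv hfixt ?_
    intro g hg eM hM eS hS hx ht'
    have hg1 : ContMDiff 𝓘(ℝ, E) 𝓘(ℝ, E) ∞ (fun y : M => g • y) :=
      ContMDiffSMul.contMDiff_const_smul (I := 𝓘(ℝ, E')) g
    have c1 : ContDiffAt ℝ ∞ (fun b : F => eM (g • ι (eS.symm b))) (eS t) :=
      contDiffAt_in_charts (f := fun s => g • ι s) hS hM ((hg1.comp hι.contMDiff) t) ht'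
        (by rwa [hfixt g hg])
    have c2 : ContDiffAt ℝ ∞ (fun b : F => eM (ι (eS.symm b))) (eS t) :=
      contDiffAt_in_charts (f := ι) hS hM (hι.contMDiff t) ht' hx
    have d1 := (c1.fderiv_right (m := 0) (by simp)).continuousAt
    have d2 := (c2.fderiv_right (m := 0) (by simp)).continuousAt
    -- The two first derivatives are continuous at `eS t` and coincide at points accumulating there,
    -- so they coincide in the limit; the local lemma then applies at `t`.
    by_contra hne
    have hev := ((d1.ne_iff_eventually_ne d2).1 hne)
    have hev' := (eS.continuousAt ht').eventually hev
    refine (mem_closure_iff_frequently.1 ht) ?_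
    filter_upwards [hev', eS.open_source.mem_nhds ht'] with r hr hrS hrA
    apply hr
    have hsymm : Tendsto eS.symm (𝓝 (eS r)) (𝓝 r) := by
      have := (eS.continuousAt_symm (eS.map_source hrS)).tendsto
      rwa [eS.left_inv hrS] at this
    refine Filter.EventuallyEq.fderiv_eq ?_
    filter_upwards [hsymm.eventually hrA] with b hb
    rw [hb g hg]
  have hmem : s₀ ∈ A := eventually_smul_eq_of_fderiv_eq (E' := E') hι hZ hinv hfix hD
  have huniv := IsClopen.eq_univ ⟨hclosed, hopen⟩ ⟨s₀, hmem⟩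
  have hs : s ∈ A := huniv ▸ mem_univ s
  exact hs.self_of_nhds

/-- The isotropy group of a principal point fixes every point of a normal slice. -/
theorem IsNormalSlice.stabilizer_smul_eq [T2Space M] [ContMDiffSMul 𝓘(ℝ, E') 𝓘(ℝ, E) ∞ G M]
    [ProperSMul G M] [RiemannianBundle (fun x : M => TangentSpace 𝓘(ℝ, E) x)]
    [IsManifold 𝓘(ℝ, E) ∞ M] [IsManifold 𝓘(ℝ, E') ∞ G] [IsManifold 𝓘(ℝ, F) ∞ S]
    [ConnectedSpace S] {ι : S → M} {s₀ : S}
    (hslice : IsNormalSlice (E := E) (E' := E') (F := F) G ι s₀)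
    (hprinc : IsPrincipalPoint (E := E) (E' := E') G (ι s₀)) (s : S) :
    ∀ g ∈ MulAction.stabilizer G (ι s₀), g • ι s = ι s := by
  have hι := hslice.isSmoothEmbedding
  refine smul_eq_of_fderiv_eq (E' := E') hι (isCompact_stabilizer (ι s₀)) hslice.smul_mem
    (s₀ := s₀) (fun g hg => hg) ?_ s
  intro g hg eM hM eS hS hx hs
  have hgx : g • ι s₀ = ι s₀ := hg
  have hg1 : ContMDiff 𝓘(ℝ, E) 𝓘(ℝ, E) ∞ (fun y : M => g • y) :=
    ContMDiffSMul.contMDiff_const_smul (I := 𝓘(ℝ, E')) g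
  have hd1 : MDifferentiableAt 𝓘(ℝ, E) 𝓘(ℝ, E) (fun y : M => g • y) (ι s₀) :=
    (hg1 _).mdifferentiableAt (by simp)
  have hd2 : MDifferentiableAt 𝓘(ℝ, F) 𝓘(ℝ, E) ι s₀ :=
    (hι.contMDiff s₀).mdifferentiableAt (by simp)
  ext w
  have a := fderiv_in_charts (f := fun s => g • ι s) hS hM (MDifferentiableAt.comp s₀ hd1 hd2)
    hs (by rwa [hgx]) w
  have b := fderiv_in_charts (f := ι) hS hM hd2 hs hx w
  refine a.trans (Eq.trans ?_ b.symm)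
  set v : F := (mfderiv 𝓘(ℝ, F) 𝓘(ℝ, F) eS.symm (eS s₀) w : F) with hv
  have h1 : tangentMap 𝓘(ℝ, F) 𝓘(ℝ, E) (fun s => g • ι s) ⟨s₀, v⟩
      = tangentMap 𝓘(ℝ, F) 𝓘(ℝ, E) ι ⟨s₀, v⟩ := by
    refine (tangentMap_comp_at (g := fun y : M => g • y) (f := ι) ⟨s₀, v⟩ hd1 hd2).trans ?_
    -- The tangent vectors of `Σ` at `x₀` are horizontal, and the isotropy group of a principal
    -- point acts trivially on those.
    refine hprinc g hg _ fun u hu => ?_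
    exact hslice.orthogonal u hu _ ⟨v, rfl⟩
  exact congrArg (fun p : TangentBundle 𝓘(ℝ, E) M =>
    (mfderiv 𝓘(ℝ, E) 𝓘(ℝ, E) eM p.1 p.2 : E)) h1

end FixedPoints

end

/-! ### Assembly of equivariance and transport. -/

theorem mainTheorem7
    -- `M` is a complete Riemannian manifold
    {E : Type*} [NormedAddCommGroup E] [NormedSpace ℝ E] [FiniteDimensional ℝ E]
    {M : Type*} [EMetricSpace M] [ChartedSpace E M] [IsManifold 𝓘(ℝ, E) ∞ M]
    [SecondCountableTopology M]
    [RiemannianBundle (fun x : M => TangentSpace 𝓘(ℝ, E) x)]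
    [IsContMDiffRiemannianBundle 𝓘(ℝ, E) ∞ E (fun x : M => TangentSpace 𝓘(ℝ, E) x)]
    [IsRiemannianManifold 𝓘(ℝ, E) M] [CompleteSpace M] [MeasurableSpace M] [BorelSpace M]
    -- `G` is a Lie group with a proper isometric action on `M`
    {E' : Type*} [NormedAddCommGroup E'] [NormedSpace ℝ E'] [FiniteDimensional ℝ E']
    {G : Type*} [TopologicalSpace G] [ChartedSpace E' G] [Group G] [LieGroup 𝓘(ℝ, E') ∞ G]
    [MulAction G M] [ContMDiffSMul 𝓘(ℝ, E') 𝓘(ℝ, E) ∞ G M] [ProperSMul G M]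
    (hiso : IsRiemannianIsometricAction E G M)
    -- `Σ = ι(S)` is a (connected) normal slice through the principal point `x₀ = ι s₀`
    {F : Type*} [NormedAddCommGroup F] [NormedSpace ℝ F] [FiniteDimensional ℝ F]
    {S : Type*} [TopologicalSpace S] [ChartedSpace F S] [IsManifold 𝓘(ℝ, F) ∞ S]
    [ConnectedSpace S]
    (ι : S → M) (s₀ : S)
    (hslice : IsNormalSlice (E := E) (E' := E') (F := F) G ι s₀)
    (hprinc : IsPrincipalPoint (E := E) (E' := E') G (ι s₀))
    -- `μ = ρ vol` is a finite absolutely continuous measure, whose density is constant along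
    -- horizontal directions: `ρ(·, x) = ρ(·, y)` for all `x, y ∈ Σ`
    (μ : Measure M) [IsFiniteMeasure μ] (ρ : M → ℝ≥0∞) (hρ : Measurable ρ)
    (hμ : μ = (riemannianVol E M).withDensity ρ)
    (hhor : ∀ g : G, ∀ x ∈ range ι, ∀ y ∈ range ι, ρ (g • x) = ρ (g • y))
    -- `ψ` is of class `C³` on `Σ` and is extended to `G·Σ` by `ψ(g·x) = ψ(x)`
    (ψ : M → ℝ) (hψ : ContMDiff 𝓘(ℝ, F) 𝓘(ℝ, ℝ) 3 (ψ ∘ ι))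
    (hψG : ∀ g : G, ∀ x ∈ range ι, ψ (g • x) = ψ x) :
    (∀ g h : G, ∀ x ∈ range ι,
      expGradientMap (E := E) ψ (g • h • x) = g • expGradientMap (E := E) ψ (h • x)) ∧
    ∀ x ∈ range ι, expGradientMap (E := E) ψ x ∈ range ι →
      IsTransportMap (expGradientMap (E := E) ψ)
        (conditionalMeasure (E := E) (E' := E') G (ι s₀) ρ x)
        (conditionalMeasure (E := E) (E' := E') G (ι s₀) ρ (expGradientMap (E := E) ψ x)) := by

  have hι := hslice.isSmoothEmbedding
  have hsm : ∀ g : G, ContMDiff 𝓘(ℝ, E) 𝓘(ℝ, E) ∞ (fun y : M => g • y) := fun g =>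
    ContMDiffSMul.contMDiff_const_smul (I := 𝓘(ℝ, E')) g
  -- Translating by `h` shows that `G·Σ` is a neighbourhood of each of its points, not only of those
  -- of `Σ`.
  have hsat : ∀ (h : G), ∀ x ∈ range ι,
      ∀ᶠ y in nhds (h • x), ∃ k : G, ∃ z ∈ range ι, y = k • z := by
    rintro h _ ⟨s, rfl⟩
    have h1 := saturation_mem_nhds hι.contMDiff s (hslice.sup_eq_top s)
    have h2 : Filter.Tendsto (fun y : M => h⁻¹ • y) (nhds (h • ι s)) (nhds (ι s)) := by
      have := ((hsm h⁻¹).continuous.tendsto (h • ι s))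
      rwa [inv_smul_smul] at this
    filter_upwards [h2 h1] with y hy
    obtain ⟨k, z, hz, hkz⟩ := hy
    exact ⟨h * k, z, hz, by rw [mul_smul, ← hkz, smul_inv_smul]⟩
  have hequiv : ∀ g h : G, ∀ x ∈ range ι,
      expGradientMap (E := E) ψ (g • h • x) = g • expGradientMap (E := E) ψ (h • x) := by
    intro g h x hx
    refine expGradientMap_isometry (f := fun y : M => g • y) (f' := fun y : M => g⁻¹ • y)
      (hsm g) (hsm g⁻¹) (fun y => inv_smul_smul g y) (fun y => smul_inv_smul g y)
      (fun y u v => hiso g y u v) (fun y u v => hiso g⁻¹ y u v) ?_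
    -- Invariance of `ψ` is known only on `G·Σ`; this neighbourhood supplies the germ that the
    -- gradient sees.
    filter_upwards [hsat h x hx] with y hy
    obtain ⟨k, z, hz, rfl⟩ := hy
    simp only [Function.comp_apply]
    rw [smul_smul, hψG _ z hz, hψG _ z hz]
  have hstab : ∀ x ∈ range ι, MulAction.stabilizer G (ι s₀) ≤ MulAction.stabilizer G x := by
    rintro _ ⟨s, rfl⟩ g hg
    exact hslice.stabilizer_smul_eq hprinc s g hg
  refine ⟨hequiv, fun x hx hTx => ?_⟩
  refine isTransportMap_conditionalMeasure hρ (hstab x hx) (hstab _ hTx)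
    (fun g => hhor g x hx _ hTx) fun g => ?_
  have h1 := hequiv g 1 x hx
  rwa [one_smul] at h1
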